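/- **Setting.** Let $T\ge 0$, and let $(\Omega,\mathcal F,(\mathcal F_t)_{t\in[0,T]},\mathbb P)$ be a filtered probability space satisfying the usual conditions. Let $\underline S\le S\le\overline S$ be adapted real-valued processes on $[0,T]$ with càdlàg paths (bid price, an intermediate price such as a semimartingale, and ask price). Stopping times take values in $[0,T]\cup\{\infty\}$, and stochastic intervals such as $]\!]\sigma,\tau]\!]$ are subsets of $\Omega\times[0,T]$. **Cost term.** Fix a path and $[a,b]\subseteq[0,T]$. For a partition $P=\{a=t_0\le\dots\le t_n=b\}$ and a modified intermediate subdivision $\lambda=(s_1,\dots,s_n)$, $s_i\in[t_{i-1},t_i)$, put $$R(\varphi,P,\lambda)=\sum_{i=1}^n(\overline S_{s_i}-S_{s_i})(\varphi_{t_i}-\varphi_{t_{i-1}})^+ +\sum_{i=1}^n(S_{s_i}-\underline S_{s_i})(\varphi_{t_i}-\varphi_{t_{i-1}})^-.$$ The cost term $C(\varphi,[a,b])\in[0,\infty]$ exists and equals $c$ if for every $\varepsilon>0$ there is a partition $P_\varepsilon$ of $[a,b]$ such that for all partitions $P\supseteq P_\varepsilon$ of $[a,b]$ and all modified intermediate subdivisions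 $\lambda$ of $P$ one has $|c-R(\varphi,P,\lambda)|<\varepsilon$ (if $c<\infty$), respectively $|R(\varphi,P,\lambda)|>1/\varepsilon$ (if $c=\infty$). For stopping times $\sigma\le\tau$ we write $C(\varphi,[\sigma,\tau])$ for $C(\varphi,[\sigma\wedge T,\tau\wedge T])$. **Almost simple strategies.** A predictable process $\psi$ of finite variation is almost simple if there are stopping times $(\tau_n)_{n\ge0}$ with $\tau_n<\tau_{n+1}$ on $\{\tau_n<\infty\}$ and $\#\{n:\tau_n(\omega)<\infty\}<\infty$ for all $\omega$ such that $\psi=\sum_{n\ge0}\bigl(\psi_{\tau_n}1_{[\![\tau_n]\!]}+\psi_{\tau_n+}1_{]\!]\tau_n,\tau_{n+1}[\![}\bigr)$. **Proposition.** Let $\varphi$ be a bounded predictable process and let $\sigma\le\tau$ be stopping times such that $\inf_{\sigma(\omega)\le t<\tau(\omega)}(\overline S_t(\omega)-\underline S_t(\omega))>0$ for all $\omega\in\Omega$ (with $\inf\emptyset=\infty$) and $C(\varphi,[\sigma,\tau])<\infty$ a.s. Then there exists a uniformly bounded sequence $(\varphi^n)_{n\in\mathbb N}$ of predictable processes such that,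 for all $n\ge1$, the process $\varphi^n1_{]\!]\sigma,\tau]\!]}$ is almost simple, $\varphi^n_\sigma=\varphi_\sigma$ on $\{\sigma<\infty\}$, and $|\varphi-\varphi^n|\le 1/n$ on $[\![\sigma,\tau]\!]$ up to evanescence. Moreover, almost surely, all the cost terms below exist and are finite, and $$\sup_{t\in[0,T]}\bigl|C(\varphi^n,[\sigma\wedge t,\tau\wedge t])-C(\varphi,[\sigma\wedge t,\tau\wedge t])\bigr|\longrightarrow0\quad(n\to\infty).$$ -/

import Mathlib

open MeasureTheory Filter Set
open scoped Topology NNReal ENNReal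

namespace BidAsk

/-- The time interval `[0, T]`. -/
abbrev Time (T : ℝ≥0) : Type := Set.Iic T

section Paths

variable {ι : Type*} [LinearOrder ι]

/-- A partition `a = t₀ ≤ t₁ ≤ … ≤ tₙ = b` of the interval `[a, b]`. -/
structure IntervalPartition (a b : ι) where
  /-- the number of subintervals -/
  n : ℕ
  /-- the partition points -/
  t : Fin (n + 1) → ι
  mono : Monotone t
  first : t 0 = a
  last : t (Fin.last n) = b

/-- `P'` is a refinement of `P`: every point of `P` is a point of `P'`. -/
def IntervalPartition.Refines {a b : ι} (P' P : IntervalPartition a b) : Prop :=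
  Set.range P.t ⊆ Set.range P'.t

/-- Modified intermediate subdivision: one point in each half-open interval `[tᵢ₋₁, tᵢ)`. -/
def IntervalPartition.IsSubdivision {a b : ι} (P : IntervalPartition a b)
    (s : Fin P.n → ι) : Prop :=
  ∀ i, P.t i.castSucc ≤ s i ∧ s i < P.t i.succ

/-- The modified Riemann-Stieltjes sum of the path `φ` along the partition `P` and the intermediate
points `s`, for the bid path `bid`, the ask path `ask` and the path `S` in between. -/
def riemannSum (bid S ask φ : ι → ℝ) {a b : ι} (P : IntervalPartition a b)
    (s : Fin P.n → ι) : ℝ :=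
  ∑ i, (ask (s i) - S (s i)) * max (φ (P.t i.succ) - φ (P.t i.castSucc)) 0 +
    ∑ i, (S (s i) - bid (s i)) * max (-(φ (P.t i.succ) - φ (P.t i.castSucc))) 0

/-- The cost term of the path `φ` on `[a, b]` exists and equals `c ∈ [0, ∞]`. -/
def HasCostTerm (bid S ask φ : ι → ℝ) (a b : ι) (c : ℝ≥0∞) : Prop :=
  ∀ ε : ℝ, 0 < ε → ∃ P₀ : IntervalPartition a b, ∀ P : IntervalPartition a b, P.Refines P₀ →
    ∀ s : Fin P.n → ι, P.IsSubdivision s →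
      (c ≠ ∞ → |c.toReal - riemannSum bid S ask φ P s| < ε) ∧
      (c = ∞ → 1 / ε < |riemannSum bid S ask φ P s|)

/-- The cost term `C(φ, [a, b]) ∈ [0, ∞]`. There is at most one `c` with `HasCostTerm … c` when
`a ≤ b` (see `HasCostTerm.costTerm_eq`); if there is none, the value is `∞`, so
that `costTerm … ≠ ∞` says that the cost term exists and is finite. -/
noncomputable def costTerm (bid S ask φ : ι → ℝ) (a b : ι) : ℝ≥0∞ :=
  sInf {c | HasCostTerm bid S ask φ a b c}

/-- Two partitions have a common refinement that possesses an intermediate subdivision. -/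
theorem IntervalPartition.exists_common {a b : ι} (P Q : IntervalPartition a b) :
    ∃ R : IntervalPartition a b, R.Refines P ∧ R.Refines Q ∧ ∃ s, R.IsSubdivision s := by
  classical
  have bd : ∀ (P : IntervalPartition a b) i, a ≤ P.t i ∧ P.t i ≤ b := fun P i =>
    ⟨P.first.symm.le.trans (P.mono (Fin.zero_le i)), (P.mono (Fin.le_last i)).trans P.last.le⟩
  let F : Finset ι := Finset.univ.image P.t ∪ Finset.univ.image Q.t
  have hF : ∀ x, x ∈ F ↔ x ∈ Set.range P.t ∨ x ∈ Set.range Q.t := by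
    intro x; simp [F]
  have haF : a ∈ F := (hF a).2 (Or.inl ⟨0, P.first⟩)
  have hbF : b ∈ F := (hF b).2 (Or.inl ⟨_, P.last⟩)
  have hbd : ∀ x ∈ F, a ≤ x ∧ x ≤ b := by
    intro x hx
    rcases (hF x).1 hx with ⟨i, rfl⟩ | ⟨i, rfl⟩
    exacts [bd P i, bd Q i]
  obtain ⟨n, hn⟩ : ∃ n, F.card = n + 1 :=
    Nat.exists_eq_succ_of_ne_zero (Finset.card_ne_zero_of_mem haF)
  let e := F.orderEmbOfFin hn
  have he : Set.range e = (F : Set ι) := F.range_orderEmbOfFin hn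
  have hmem : ∀ x ∈ F, ∃ i, e i = x := fun x hx => by
    have : x ∈ Set.range e := he ▸ hx
    exact this
  have hmem' : ∀ i, e i ∈ F := fun i => F.orderEmbOfFin_mem hn i
  refine ⟨⟨n, e, e.monotone, ?_, ?_⟩, ?_, ?_, fun i => e i.castSucc, ?_⟩
  · obtain ⟨i, hi⟩ := hmem a haF
    exact le_antisymm (hi ▸ e.monotone (Fin.zero_le i)) (hbd _ (hmem' _)).1
  · obtain ⟨i, hi⟩ := hmem b hbF
    exact le_antisymm (hbd _ (hmem' _)).2 (hi ▸ e.monotone (Fin.le_last i))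
  · intro x hx
    exact hmem x ((hF x).2 (Or.inl hx))
  · intro x hx
    exact hmem x ((hF x).2 (Or.inr hx))
  · intro i
    exact ⟨le_rfl, e.strictMono i.castSucc_lt_succ⟩

theorem HasCostTerm.unique {bid S ask φ : ι → ℝ} {a b : ι} {c d : ℝ≥0∞}
    (hc : HasCostTerm bid S ask φ a b c) (hd : HasCostTerm bid S ask φ a b d) : c = d := by
  have key : ∀ ε : ℝ, 0 < ε → ∃ r : ℝ,
      ((c ≠ ∞ → |c.toReal - r| < ε) ∧ (c = ∞ → 1 / ε < |r|)) ∧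
      ((d ≠ ∞ → |d.toReal - r| < ε) ∧ (d = ∞ → 1 / ε < |r|)) := by
    intro ε hε
    obtain ⟨P, hP⟩ := hc ε hε
    obtain ⟨Q, hQ⟩ := hd ε hε
    obtain ⟨R, hRP, hRQ, s, hs⟩ := P.exists_common Q
    exact ⟨_, hP R hRP s hs, hQ R hRQ s hs⟩
  have mixed : ∀ x : ℝ, ¬ ∀ ε : ℝ, 0 < ε → ∃ r : ℝ, |x - r| < ε ∧ 1 / ε < |r| := by
    intro x h
    have hx : (0 : ℝ) < |x| + 2 := by positivity
    obtain ⟨r, h1, h2⟩ := h (1 / (|x| + 2)) (by positivity)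
    rw [one_div_one_div] at h2
    have h3 : 1 / (|x| + 2) ≤ 1 := by
      rw [div_le_one hx]; linarith [abs_nonneg x]
    have h4 : |r| - |x| ≤ |r - x| := abs_sub_abs_le_abs_sub r x
    rw [abs_sub_comm] at h4
    linarith
  by_cases h1 : c = ∞ <;> by_cases h2 : d = ∞
  · rw [h1, h2]
  · refine absurd (fun ε hε => ?_) (mixed d.toReal)
    obtain ⟨r, hr1, hr2⟩ := key ε hε
    exact ⟨r, hr2.1 h2, hr1.2 h1⟩
  · refine absurd (fun ε hε => ?_) (mixed c.toReal)
    obtain ⟨r, hr1, hr2⟩ := key ε hε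
    exact ⟨r, hr1.1 h1, hr2.2 h2⟩
  · rw [← ENNReal.toReal_eq_toReal_iff' h1 h2]
    refine eq_of_abs_sub_le_all fun ε hε => ?_
    obtain ⟨r, hr1, hr2⟩ := key (ε / 2) (by positivity)
    have e1 := hr1.1 h1
    have e2 := hr2.1 h2
    rw [abs_lt] at e1 e2
    rw [abs_le]
    constructor <;> linarith

theorem HasCostTerm.costTerm_eq {bid S ask φ : ι → ℝ} {a b : ι} {c : ℝ≥0∞}
    (hc : HasCostTerm bid S ask φ a b c) : costTerm bid S ask φ a b = c := by
  have : {c | HasCostTerm bid S ask φ a b c} = {c} :=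
    Set.eq_singleton_iff_unique_mem.2 ⟨hc, fun _ hd => HasCostTerm.unique hd hc⟩
  rw [costTerm, this, sInf_singleton]

/-- The time `s ∧ t`, for `s` possibly infinite. -/
def capAt (s : WithTop ι) (t : ι) : ι := (min s (t : WithTop ι)).untopD t

/-- Right-continuous paths with (finite) left limits. -/
def IsCadlag [TopologicalSpace ι] (f : ι → ℝ) : Prop :=
  ∀ t, ContinuousWithinAt f (Set.Ici t) t ∧ ∃ l, Tendsto f (𝓝[<] t) (𝓝 l)

end Paths

section Processes

variable {Ω : Type*} {m : MeasurableSpace Ω} {T : ℝ≥0}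

/-- Every null set (with respect to the outer measure) belongs to `𝓕 0`. In particular the
probability space is complete. -/
def IsCompleteFiltration (𝓕 : Filtration (Time T) m) (P : Measure Ω) : Prop :=
  ∀ A : Set Ω, P A = 0 → MeasurableSet[𝓕 ⊥] A

/-- The process `X 1_{]]σ, τ]]}`. -/
noncomputable def restrictIoc (X : Time T → Ω → ℝ) (σ τ : Ω → WithTop (Time T)) :
    Time T → Ω → ℝ :=
  fun t ω => {u : Time T | σ ω < (u : WithTop (Time T)) ∧ (u : WithTop (Time T)) ≤ τ ω}.indicator
    (fun u => X u ω) t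

/-- Almost simple strategies: predictable processes `ψ` of finite variation such that
`ψ = ∑ₙ (ψ_{τₙ} 1_{[[τₙ]]} + ψ_{τₙ+} 1_{]]τₙ, τₙ₊₁[[})` for stopping times `τₙ` that are strictly
increasing as long as they are finite, only finitely many of them being finite on each path.
The representation means that `ψ` vanishes before `τ₀` and that at every time
`t ∈ ]τₙ, τₙ₊₁[` its value is the right limit `ψ_{τₙ+}`. -/
def IsAlmostSimple (𝓕 : Filtration (Time T) m) (ψ : Time T → Ω → ℝ) : Prop :=
  IsStronglyPredictable 𝓕 ψ ∧
  (∀ ω, BoundedVariationOn (fun t => ψ t ω) Set.univ) ∧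
  ∃ ρ : ℕ → Ω → WithTop (Time T),
    (∀ n, IsStoppingTime 𝓕 (ρ n)) ∧
    (∀ n ω, ρ n ω ≠ ⊤ → ρ n ω < ρ (n + 1) ω) ∧
    (∀ ω, {n | ρ n ω ≠ ⊤}.Finite) ∧
    (∀ ω (t : Time T), (t : WithTop (Time T)) < ρ 0 ω → ψ t ω = 0) ∧
    (∀ n ω (s t : Time T), ρ n ω = (s : WithTop (Time T)) → s < t →
      (t : WithTop (Time T)) < ρ (n + 1) ω →
      Tendsto (fun u => ψ u ω) (𝓝[>] s) (𝓝 (ψ t ω)))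

end Processes

end BidAsk

open BidAsk

/-! Two pathwise facts and one stochastic construction carry the proof.

Finite cost forces bounded variation. On a short interval where the spread is at least δ and the
prices barely move, buying or selling costs at least δ/4 per unit throughout. The costly direction
is then controlled by the cost, and the other direction by the costly one and the net increment
(`varSum_le_weightedSum_add`, `HasCostTerm.boundedVariationOn`).

Conversely, a path f of bounded variation has a finite cost term. On a chain on which the prices
oscillate by at most η and which misses little of the variation V, the error of the weighted sum is
at most ηV + M(V − variation along the chain), with M a bound for the half-spreads
(`exists_hasCostTerm`). Now let ψₖ → f uniformly with Var ψₖ ≤ Var f. Along a fixed chain the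
variation of ψₖ tends to that of f, so the same chain eventually nearly exhausts Var ψₖ too. The
error bound is inherited by the chain stopped at t, which makes the convergence of costs uniform in
t (`costTerm_tendsto_uniformly`).

It remains to approximate φ uniformly by almost simple processes without increasing the variation.
Starting from σ, the next time is the first one at which φ differs by more than ε from its right
limit at the current time, or τ. These are stopping times by the debut theorem, which rests on
measurable projection. Bounded variation supplies the one-sided limits that make the times strictly
increasing and finite in number. The approximation ψ is frozen at the last right limit, except that
it equals φ where the threshold is exceeded, which within a cell happens at most at its right end.
Up to arbitrarily small errors ψ is φ composed with a monotone time change, so its variation is no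
larger (`IsTimeSeq.eVariationOn_le`). -/

namespace BidAsk

/-! ### Measurable projection via analytic sets -/

section Projection

/-- Inner regularity of analytic sets with respect to compact sets. -/
theorem analyticSet_exists_isCompact_measure_ge {X : Type*} [TopologicalSpace X]
    [TopologicalSpace.PseudoMetrizableSpace X] [MeasurableSpace X] [BorelSpace X] (μ : Measure X)
    [IsFiniteMeasure μ] {s : Set X} (hs : AnalyticSet s) {r : ℝ≥0∞} (hr : r < μ s) :
    ∃ K ⊆ s, IsCompact K ∧ r ≤ μ K := by
  rw [AnalyticSet] at hs
  rcases hs with rfl | ⟨f, hf, rfl⟩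
  · simp at hr
  -- Continuity from below of the outer measure lets one coordinate at a time be bounded while the
  -- image keeps measure above r.
  have step : ∀ (n : ℕ) (S : Set (ℕ → ℕ)), r < μ (f '' S) →
      ∃ j : ℕ, r < μ (f '' (S ∩ {x | x n ≤ j})) := by
    intro n S hS
    have hU : f '' S = ⋃ j : ℕ, f '' (S ∩ {x | x n ≤ j}) := by
      rw [← image_iUnion, ← inter_iUnion]
      congr 1
      refine (inter_eq_left.2 fun x _ => ?_).symm
      exact mem_iUnion.2 ⟨x n, (le_rfl : x n ≤ x n)⟩
    have hm : Monotone fun j : ℕ => f '' (S ∩ {x | x n ≤ j}) := fun i j hij =>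
      image_mono (inter_subset_inter_right _ fun x (hx : x n ≤ i) => hx.trans hij)
    rw [hU, hm.measure_iUnion] at hS
    exact lt_iSup_iff.1 hS
  choose! j hj using step
  let S : ℕ → Set (ℕ → ℕ) := fun n => Nat.rec univ (fun n S => S ∩ {x | x n ≤ j n S}) n
  have hS0 : S 0 = univ := rfl
  have hSs : ∀ n, S (n + 1) = S n ∩ {x | x n ≤ j n (S n)} := fun n => rfl
  have hSr : ∀ n, r < μ (f '' S n) := by
    intro n
    induction n with
    | zero => simpa [hS0] using hr
    | succ n ih => rw [hSs]; exact hj n _ ih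
  let k : ℕ → ℕ := fun n => j n (S n)
  have hSk : ∀ n x, x ∈ S n → ∀ i < n, x i ≤ k i := by
    intro n
    induction n with
    | zero => intro x _ i hi; omega
    | succ n ih =>
      intro x hx i hi
      rw [hSs] at hx
      rcases Nat.lt_succ_iff_lt_or_eq.1 hi with h | rfl
      · exact ih x hx.1 i h
      · exact hx.2
  let K₀ : Set (ℕ → ℕ) := Set.pi univ fun i => Iic (k i)
  have hK₀ : IsCompact K₀ := isCompact_univ_pi fun i => (finite_Iic _).isCompact
  refine ⟨f '' K₀, image_subset_range _ _, hK₀.image hf, ?_⟩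
  rw [Set.measure_eq_iInf_isOpen]
  refine le_iInf₂ fun U hKU => le_iInf fun hU => ?_
  suffices ∃ n, S n ⊆ f ⁻¹' U by
    obtain ⟨n, hn⟩ := this
    exact (hSr n).le.trans (measure_mono (image_subset_iff.2 hn))
  by_contra hcon
  have : ∀ n, ∃ x ∈ S n, x ∉ f ⁻¹' U := fun n => not_subset.1 fun h => hcon ⟨n, h⟩
  choose x hxS hxU using this
  -- The truncated points lie in the compact box. For fixed i the truncation is inactive once n > i,
  -- so the untruncated points converge along the same subsequence and must enter the open preimage
  -- of U.
  obtain ⟨y, hy, φ, hφ, hlim⟩ := hK₀.tendsto_subseq (x := fun n i => min (x n i) (k i))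
    fun n i _ => mem_Iic.2 (min_le_right _ _)
  have hlim' : Tendsto (x ∘ φ) atTop (𝓝 y) := by
    rw [tendsto_pi_nhds] at hlim ⊢
    intro i
    refine (hlim i).congr' ?_
    filter_upwards [eventually_gt_atTop i] with n hn
    exact min_eq_left (hSk _ _ (hxS (φ n)) i (hn.trans_le (hφ.id_le n)))
  have hev := hlim'.eventually ((hU.preimage hf).mem_nhds (hKU (mem_image_of_mem f hy)))
  obtain ⟨n, hn⟩ := hev.exists
  exact hxU _ hn

/-- Countably many compact subsets of s exhaust its outer measure; their union agrees almost
everywhere with the measurable hull, and s lies between the two. -/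
theorem analyticSet_nullMeasurableSet {X : Type*} [TopologicalSpace X]
    [TopologicalSpace.MetrizableSpace X] [MeasurableSpace X] [BorelSpace X] (μ : Measure X)
    [IsFiniteMeasure μ] {s : Set X} (hs : AnalyticSet s) : NullMeasurableSet s μ := by
  rcases eq_or_ne (μ s) 0 with h0 | h0
  · exact NullMeasurableSet.of_null h0
  obtain ⟨r, -, hr, hlim⟩ := exists_seq_strictMono_tendsto' (pos_iff_ne_zero.2 h0)
  choose K hKs hK hKr using fun n =>
    analyticSet_exists_isCompact_measure_ge μ hs (r := r n) (hr n).2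
  have hL : MeasurableSet (⋃ n, K n) := MeasurableSet.iUnion fun n => (hK n).measurableSet
  have hge : μ s ≤ μ (⋃ n, K n) :=
    le_of_tendsto' hlim fun n => (hKr n).trans (measure_mono (subset_iUnion K n))
  have hsub : (⋃ n, K n) ⊆ toMeasurable μ s := (iUnion_subset hKs).trans (subset_toMeasurable μ s)
  have hae : (⋃ n, K n) =ᵐ[μ] toMeasurable μ s :=
    ae_eq_of_subset_of_measure_ge hsub (by rwa [measure_toMeasurable]) hL.nullMeasurableSet
      (measure_ne_top _ _)
  refine NullMeasurableSet.congr hL.nullMeasurableSet ?_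
  refine (iUnion_subset hKs).eventuallyLE.antisymm ?_
  exact (subset_toMeasurable μ s).eventuallyLE.trans hae.symm.le

/-- A measurable set of the product depends on ω only through countably many events, and a pairing
function codes countably many such codings into one. This replaces the arbitrary space Ω by the
Cantor space, where analytic sets are available. -/
theorem exists_preimage_prod_cantor {X Ω : Type*} [MeasurableSpace X] [MeasurableSpace Ω]
    {A : Set (X × Ω)} (hA : MeasurableSet A) :
    ∃ e : Ω → ℕ → Bool, Measurable e ∧ ∃ A' : Set (X × (ℕ → Bool)), MeasurableSet A' ∧
      A = Prod.map id e ⁻¹' A' := by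
  classical
  rw [← generateFrom_prod] at hA
  induction A, hA using MeasurableSpace.generateFrom_induction with
  | hC A hA _ =>
    obtain ⟨B, hB, C, hC, rfl⟩ := hA
    refine ⟨fun ω _ => decide (ω ∈ C), ?_, B ×ˢ {x | x 0 = true}, ?_, ?_⟩
    · exact measurable_pi_lambda _ fun _ => measurable_to_bool (by
        convert (show MeasurableSet C from hC) using 1
        ext; simp)
    · exact MeasurableSet.prod hB (measurable_pi_apply (X := fun _ : ℕ => Bool) 0
        (measurableSet_singleton true))
    · ext ⟨a, b⟩; simp
  | empty => exact ⟨fun _ _ => true, measurable_const, ∅, .empty, rfl⟩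
  | compl A _ ih =>
    obtain ⟨e, he, A', hA', rfl⟩ := ih
    exact ⟨e, he, A'ᶜ, hA'.compl, rfl⟩
  | iUnion s _ ih =>
    choose e he A' hA' hs using ih
    have hπ : ∀ n, Measurable fun (x : ℕ → Bool) (j : ℕ) => x (Nat.pair n j) := fun n =>
      measurable_pi_lambda _ fun j => measurable_pi_apply _
    refine ⟨fun ω k => e k.unpair.1 ω k.unpair.2, ?_,
      ⋃ n, Prod.map id (fun (x : ℕ → Bool) (j : ℕ) => x (Nat.pair n j)) ⁻¹' A' n, ?_, ?_⟩
    · exact measurable_pi_lambda _ fun k => (measurable_pi_apply _).comp (he _)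
    · exact MeasurableSet.iUnion fun n => (measurable_id.prodMap (hπ n)) (hA' n)
    · rw [preimage_iUnion]
      refine iUnion_congr fun n => ?_
      rw [hs n, ← preimage_comp]
      congr 1
      ext p <;> simp

/-- Measurable projection theorem. -/
theorem nullMeasurableSet_snd_image {X Ω : Type*} [MeasurableSpace X] [StandardBorelSpace X]
    [MeasurableSpace Ω] (μ : Measure Ω) [IsFiniteMeasure μ] {A : Set (X × Ω)}
    (hA : MeasurableSet A) : NullMeasurableSet (Prod.snd '' A) μ := by
  obtain ⟨e, he, A', hA', rfl⟩ := exists_preimage_prod_cantor hA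
  have h1 : AnalyticSet (Prod.snd '' A') := hA'.analyticSet_image measurable_snd
  have h2 := (analyticSet_nullMeasurableSet (μ.map e) h1).preimage
    (he.quasiMeasurePreserving μ)
  convert h2 using 1
  ext ω
  simp

end Projection

/-! ### Debut theorem under the usual conditions -/

section Debut

variable {Ω : Type*} {m : MeasurableSpace Ω} {T : ℝ≥0}

theorem IsCompleteFiltration.measurableSet_of_null {𝓕 : Filtration (Time T) m} {P : Measure Ω}
    (h𝓕 : IsCompleteFiltration 𝓕 P) (t : Time T) {s : Set Ω} (hs : P s = 0) :
    MeasurableSet[𝓕 t] s :=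
  𝓕.mono bot_le _ (h𝓕 s hs)

theorem IsCompleteFiltration.measurableSet_of_nullMeasurableSet {𝓕 : Filtration (Time T) m}
    {P : Measure Ω} (h𝓕 : IsCompleteFiltration 𝓕 P) (t : Time T) {s : Set Ω}
    (hs : @NullMeasurableSet Ω (𝓕 t) s (P.trim (𝓕.le t))) : MeasurableSet[𝓕 t] s := by
  obtain ⟨u, hu, hsu⟩ := hs
  have h1 : P {ω | ¬ (ω ∈ s ↔ ω ∈ u)} = 0 :=
    measure_eq_zero_of_trim_eq_zero (𝓕.le t) (ae_iff.1 hsu.mem_iff)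
  have h2 : s = (u \ {ω | ¬ (ω ∈ s ↔ ω ∈ u)}) ∪ (s ∩ {ω | ¬ (ω ∈ s ↔ ω ∈ u)}) := by
    ext ω
    simp only [mem_union, Set.mem_sdiff, mem_inter_iff, mem_ofPred_eq]
    tauto
  rw [h2]
  exact (hu.diff (h𝓕.measurableSet_of_null t h1)).union
    (h𝓕.measurableSet_of_null t (measure_mono_null inter_subset_right h1))

instance standardBorelSpace_Iic (t : ℝ≥0) : StandardBorelSpace (Set.Iic t) :=
  measurableSet_Iic.standardBorel

instance : Inhabited (Time T) := ⟨⊥⟩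

/-- The debut of a set is its infimum on each path. -/
def IsDebut (A : Set (Time T × Ω)) (ρ : Ω → WithTop (Time T)) : Prop :=
  (∀ ω t, (t, ω) ∈ A → ρ ω ≤ (t : WithTop (Time T))) ∧
  (∀ ω (x : WithTop (Time T)), ρ ω < x → ∃ t, (t, ω) ∈ A ∧ (t : WithTop (Time T)) < x) ∧
  (∀ ω, ρ ω ≠ ⊤ → ∃ t, (t, ω) ∈ A)

theorem exists_isDebut (A : Set (Time T × Ω)) : ∃ ρ, IsDebut A ρ := by
  have : ∀ ω, ∃ r : WithTop (Time T), IsGLB ((fun t : Time T => (t : WithTop (Time T))) ''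
      {t | (t, ω) ∈ A}) r ∧ (r ≠ ⊤ → ∃ t, (t, ω) ∈ A) := by
    intro ω
    rcases eq_empty_or_nonempty {t | (t, ω) ∈ A} with h | ⟨t₀, h₀⟩
    · refine ⟨⊤, ?_, fun h => absurd rfl h⟩
      rw [h, image_empty]
      exact isGLB_empty
    · have hb : BddBelow {t | (t, ω) ∈ A} := ⟨⊥, fun _ _ => bot_le⟩
      refine ⟨((sInf {t | (t, ω) ∈ A} : Time T) : WithTop (Time T)), ?_, fun _ => ⟨t₀, h₀⟩⟩
      have hg := isGLB_csInf ⟨t₀, h₀⟩ hb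
      refine ⟨?_, fun b hb' => ?_⟩
      · rintro _ ⟨t, ht, rfl⟩
        exact WithTop.coe_le_coe.2 (hg.1 ht)
      · induction b with
        | top => exact absurd (hb' ⟨t₀, h₀, rfl⟩) (by simp)
        | coe b =>
          exact WithTop.coe_le_coe.2 (hg.2 fun t ht => WithTop.coe_le_coe.1 (hb' ⟨t, ht, rfl⟩))
  choose ρ h1 h2 using this
  refine ⟨ρ, fun ω t ht => (h1 ω).1 (mem_image_of_mem _ ht), fun ω x hx => ?_, h2⟩
  obtain ⟨_, ⟨t, ht, rfl⟩, hlt⟩ := (isGLB_lt_iff (h1 ω)).1 hx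
  exact ⟨t, ht, hlt⟩

/-- Debut theorem for predictable sets. -/
theorem IsDebut.isStoppingTime {𝓕 : Filtration (Time T) m} [𝓕.IsRightContinuous]
    {P : Measure Ω} [IsFiniteMeasure P]
    (h𝓕 : IsCompleteFiltration 𝓕 P) {A : Set (Time T × Ω)} {ρ : Ω → WithTop (Time T)}
    (h : IsDebut A ρ) (hA : MeasurableSet[𝓕.predictable] A) : IsStoppingTime 𝓕 ρ := by
  -- Predictable sets are progressive, so the part of A up to time i is measurable for the σ-algebra
  -- at time i; project it and remove the null set by completeness.
  have key : ∀ (i : Time T) (J : Set (Set.Iic i)), MeasurableSet J →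
      MeasurableSet[𝓕 i] {ω | ∃ t : Set.Iic i, t ∈ J ∧ ((t : Time T), ω) ∈ A} := by
    intro i J hJ
    refine h𝓕.measurableSet_of_nullMeasurableSet i ?_
    have : StandardBorelSpace (Set.Iic i) := measurableSet_Iic.standardBorel
    let _ : MeasurableSpace Ω := 𝓕 i
    have hpre : MeasurableSet ((fun p : Set.Iic i × Ω => ((p.1 : Time T), p.2)) ⁻¹' A) :=
      measurable_inclusion_predictable hA
    have := nullMeasurableSet_snd_image (P.trim (𝓕.le i))
      (hpre.inter (hJ.prod (MeasurableSet.univ (α := Ω))))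
    convert this using 1
    ext ω
    constructor
    · rintro ⟨t, h1, h2⟩
      exact ⟨(t, ω), ⟨h2, h1, mem_univ _⟩, rfl⟩
    · rintro ⟨⟨t, ω'⟩, ⟨h2, h1, -⟩, rfl⟩
      exact ⟨t, h1, h2⟩
  refine isStoppingTime_of_measurableSet_lt_of_isRightContinuous' (fun i => ?_) fun i hi => ?_
  · convert key i (Subtype.val ⁻¹' Set.Iio i)
      (measurableSet_Iio.preimage measurable_subtype_coe) using 1
    ext ω
    constructor
    · intro hω
      obtain ⟨t, ht, hti⟩ := h.2.1 ω _ hω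
      have hti' := WithTop.coe_lt_coe.1 hti
      exact ⟨⟨t, hti'.le⟩, hti', ht⟩
    · rintro ⟨t, hti, ht⟩
      exact (h.1 ω _ ht).trans_lt (WithTop.coe_lt_coe.2 hti)
  -- Only the terminal time has no points to its right. There right continuity says nothing, and ρ =
  -- i means that A is met at i but not before.
  · have hmax : i = ⊤ := by
      by_contra hne
      have : (𝓝[>] i).NeBot := nhdsGT_neBot_of_exists_gt ⟨⊤, lt_top_iff_ne_top.2 hne⟩
      exact this.ne hi
    have h1 := key i univ .univ
    have h2 := key i (Subtype.val ⁻¹' Set.Iio i)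
      (measurableSet_Iio.preimage measurable_subtype_coe)
    convert h1.diff h2 using 1
    ext ω
    constructor
    · intro hω
      have hω' : ρ ω = (i : WithTop (Time T)) := hω
      obtain ⟨t, ht⟩ := h.2.2 ω (by rw [hω']; simp)
      refine ⟨⟨⟨t, mem_Iic.2 (hmax ▸ le_top)⟩, mem_univ _, ht⟩, ?_⟩
      rintro ⟨s, hs, hsA⟩
      have := h.1 ω _ hsA
      rw [hω'] at this
      exact absurd (WithTop.coe_le_coe.1 this) (not_le.2 hs)
    · rintro ⟨⟨t, -, ht⟩, hno⟩
      refine le_antisymm ((h.1 ω _ ht).trans (WithTop.coe_le_coe.2 t.2)) ?_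
      by_contra hlt
      obtain ⟨s, hs, hsi⟩ := h.2.1 ω _ (not_le.1 hlt)
      have hsi' := WithTop.coe_lt_coe.1 hsi
      exact hno ⟨⟨s, hsi'.le⟩, hsi', hs⟩

end Debut

/-! ### Weighted sums and variation along chains -/

section Chains

variable {ι : Type*}

/-- The sum of the increments of `f` along `u 0, …, u n`, with weight `x i` for the positive part
and `y i` for the negative part of the `i`-th increment. -/
def weightedSum (x y : ℕ → ℝ) (f : ι → ℝ) (n : ℕ) (u : ℕ → ι) : ℝ :=
  ∑ i ∈ Finset.range n, (x i * max (f (u (i + 1)) - f (u i)) 0 +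
    y i * max (-(f (u (i + 1)) - f (u i))) 0)

/-- The variation of `f` along `u 0, …, u n`. -/
def varSum (f : ι → ℝ) (n : ℕ) (u : ℕ → ι) : ℝ :=
  ∑ i ∈ Finset.range n, |f (u (i + 1)) - f (u i)|

theorem varSum_nonneg (f : ι → ℝ) (n : ℕ) (u : ℕ → ι) : 0 ≤ varSum f n u :=
  Finset.sum_nonneg fun _ _ => abs_nonneg _

theorem varSum_sub_le {f g : ι → ℝ} {n : ℕ} {u : ℕ → ι} {e : ℝ}
    (h : ∀ i, |f (u i) - g (u i)| ≤ e) : varSum f n u - varSum g n u ≤ n * (2 * e) := by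
  rw [varSum, varSum, ← Finset.sum_sub_distrib]
  refine (Finset.sum_le_card_nsmul _ _ (2 * e) fun i _ => ?_).trans (by simp)
  have h1 := abs_sub_abs_le_abs_sub (f (u (i + 1)) - f (u i)) (g (u (i + 1)) - g (u i))
  have h2 := h i
  have h3 := h (i + 1)
  refine h1.trans ?_
  rw [abs_le] at *
  constructor <;> linarith

theorem abs_weightedSum_sub_weightedSum_le {f g : ι → ℝ} {n : ℕ} {u : ℕ → ι} {x y : ℕ → ℝ}
    {e M : ℝ} (hx : ∀ i < n, 0 ≤ x i ∧ x i ≤ M) (hy : ∀ i < n, 0 ≤ y i ∧ y i ≤ M)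
    (h : ∀ i, |f (u i) - g (u i)| ≤ e) :
    |weightedSum x y f n u - weightedSum x y g n u| ≤ n * (M * (4 * e)) := by
  rw [weightedSum, weightedSum, ← Finset.sum_sub_distrib]
  refine (Finset.abs_sum_le_sum_abs _ _).trans
    ((Finset.sum_le_card_nsmul _ _ (M * (4 * e)) fun i hi => ?_).trans (by simp))
  have hi' := Finset.mem_range.1 hi
  set p := f (u (i + 1)) - f (u i)
  set q := g (u (i + 1)) - g (u i)
  have hpq : |p - q| ≤ 2 * e := by
    have h2 := h i
    have h3 := h (i + 1)
    rw [abs_le] at *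
    constructor <;> linarith
  have h1 : |max p 0 - max q 0| ≤ 2 * e := (abs_max_sub_max_le_abs p q 0).trans hpq
  have h2 : |max (-p) 0 - max (-q) 0| ≤ 2 * e := by
    refine (abs_max_sub_max_le_abs (-p) (-q) 0).trans ?_
    rwa [show -p - -q = -(p - q) by ring, abs_neg]
  have h3 : x i * max p 0 + y i * max (-p) 0 - (x i * max q 0 + y i * max (-q) 0) =
      x i * (max p 0 - max q 0) + y i * (max (-p) 0 - max (-q) 0) := by ring
  rw [h3]
  refine (abs_add_le _ _).trans ?_
  rw [abs_mul, abs_mul, abs_of_nonneg (hx i hi').1, abs_of_nonneg (hy i hi').1]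
  have hM : 0 ≤ M := (hx i hi').1.trans (hx i hi').2
  have h4 := mul_le_mul (hx i hi').2 h1 (abs_nonneg _) hM
  have h5 := mul_le_mul (hy i hi').2 h2 (abs_nonneg _) hM
  linarith

variable [LinearOrder ι]

/-- Choosing first visits makes the indices monotone: if `u (i + 1)` were visited earlier than `u
i`, monotonicity of both chains would make that an earlier visit to `u i`. -/
theorem exists_index {u w : ℕ → ι} {n N : ℕ} (hu : Monotone u) (hw : Monotone w)
    (hsub : ∀ i ≤ n, ∃ l ≤ N, w l = u i) :
    ∃ j : ℕ → ℕ, (∀ i ≤ n, j i ≤ N ∧ w (j i) = u i ∧ ∀ l < j i, w l ≠ u i) ∧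
      ∀ i < n, j i ≤ j (i + 1) := by
  classical
  have : ∀ i, ∃ j, i ≤ n → (j ≤ N ∧ w j = u i ∧ ∀ l < j, w l ≠ u i) := by
    intro i
    by_cases hi : i ≤ n
    · obtain ⟨l, hl, hlu⟩ := hsub i hi
      have hex : ∃ l, w l = u i := ⟨l, hlu⟩
      exact ⟨Nat.find hex, fun _ => ⟨(Nat.find_min' hex hlu).trans hl, Nat.find_spec hex,
        fun l hl => Nat.find_min hex hl⟩⟩
    · exact ⟨0, fun h => absurd h hi⟩
  choose j hj using this
  refine ⟨j, hj, fun i hi => ?_⟩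
  by_contra hlt
  have h1 := hj i hi.le
  have h2 := hj (i + 1) hi
  refine h1.2.2 _ (not_le.1 hlt) (le_antisymm ?_ ?_)
  · rw [← h1.2.1]; exact hw (not_le.1 hlt).le
  · rw [h2.2.1]; exact hu (Nat.le_succ i)

theorem sum_blocks (g : ℕ → ℝ) (j : ℕ → ℕ) (n : ℕ) (hj : ∀ i < n, j i ≤ j (i + 1)) :
    j 0 ≤ j n ∧ ∑ i ∈ Finset.range n, ∑ l ∈ Finset.Ico (j i) (j (i + 1)), g l =
      ∑ l ∈ Finset.Ico (j 0) (j n), g l := by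
  induction n with
  | zero => simp
  | succ n ih =>
    obtain ⟨h1, h2⟩ := ih fun i hi => hj i (hi.trans n.lt_succ_self)
    have h3 := hj n n.lt_succ_self
    refine ⟨h1.trans h3, ?_⟩
    rw [Finset.sum_range_succ, h2, Finset.sum_Ico_consecutive g h1 h3]

theorem varSum_le_of_subset {f : ι → ℝ} {u w : ℕ → ι} {n N : ℕ} (hu : Monotone u)
    (hw : Monotone w) (hsub : ∀ i ≤ n, ∃ l ≤ N, w l = u i) : varSum f n u ≤ varSum f N w := by
  obtain ⟨j, hj, hjm⟩ := exists_index hu hw hsub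
  obtain ⟨h0, hs⟩ := sum_blocks (fun l => |f (w (l + 1)) - f (w l)|) j n hjm
  calc varSum f n u ≤ ∑ i ∈ Finset.range n, ∑ l ∈ Finset.Ico (j i) (j (i + 1)),
        |f (w (l + 1)) - f (w l)| := by
        refine Finset.sum_le_sum fun i hi => ?_
        have hi' := Finset.mem_range.1 hi
        rw [← (hj i hi'.le).2.1, ← (hj (i + 1) hi').2.1,
          ← Finset.sum_Ico_sub (fun l => f (w l)) (hjm i hi')]
        exact Finset.abs_sum_le_sum_abs _ _
    _ ≤ varSum f N w := by
        rw [hs, varSum, Finset.range_eq_Ico]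
        exact Finset.sum_le_sum_of_subset_of_nonneg
          (Finset.Ico_subset_Ico (Nat.zero_le _) (hj n le_rfl).1) fun _ _ _ => abs_nonneg _

/-- The error has two sources: the oscillation of the weights, and the excess of the summed positive
parts over the positive part of the sum, which is nonnegative by subadditivity. -/
theorem abs_sum_mul_max_sub_le (s : Finset ℕ) (c d : ℕ → ℝ) {x η M : ℝ} (hx0 : 0 ≤ x)
    (hxM : x ≤ M) (hc : ∀ l ∈ s, |c l - x| ≤ η) :
    |∑ l ∈ s, c l * max (d l) 0 - x * max (∑ l ∈ s, d l) 0| ≤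
      η * ∑ l ∈ s, max (d l) 0 + M * (∑ l ∈ s, max (d l) 0 - max (∑ l ∈ s, d l) 0) := by
  have h1 : ∑ l ∈ s, c l * max (d l) 0 - x * max (∑ l ∈ s, d l) 0 =
      ∑ l ∈ s, (c l - x) * max (d l) 0 +
        x * (∑ l ∈ s, max (d l) 0 - max (∑ l ∈ s, d l) 0) := by
    simp only [sub_mul, Finset.sum_sub_distrib, mul_sub, Finset.mul_sum]
    ring
  have h2 : 0 ≤ ∑ l ∈ s, max (d l) 0 - max (∑ l ∈ s, d l) 0 := by
    rw [sub_nonneg]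
    refine max_le (Finset.sum_le_sum fun l _ => le_max_left _ _)
      (Finset.sum_nonneg fun l _ => le_max_right _ _)
  have h3 : |∑ l ∈ s, (c l - x) * max (d l) 0| ≤ η * ∑ l ∈ s, max (d l) 0 := by
    rw [Finset.mul_sum]
    refine (Finset.abs_sum_le_sum_abs _ _).trans (Finset.sum_le_sum fun l hl => ?_)
    rw [abs_mul, abs_of_nonneg (le_max_right (d l) 0)]
    exact mul_le_mul_of_nonneg_right (hc l hl) (le_max_right _ _)
  rw [h1]
  refine (abs_add_le _ _).trans (add_le_add h3 ?_)
  rw [abs_of_nonneg (mul_nonneg hx0 h2)]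
  exact mul_le_mul_of_nonneg_right hxM h2

theorem max_add_max_neg (a : ℝ) : max a 0 + max (-a) 0 = |a| := by
  rcases le_total 0 a with h | h
  · rw [max_eq_left h, max_eq_right (by linarith), abs_of_nonneg h, add_zero]
  · rw [max_eq_right h, max_eq_left (by linarith), abs_of_nonpos h, zero_add]

/-- Weighted sums along a chain and along a refinement of it. -/
theorem abs_weightedSum_sub_le {f : ι → ℝ} {u w : ℕ → ι} {n N : ℕ} (hu : Monotone u)
    (hw : Monotone w) (hws : ∀ l < N, w l < w (l + 1)) (hsub : ∀ i ≤ n, ∃ l ≤ N, w l = u i)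
    (h0 : u 0 = w 0) (hN : u n = w N) {x y x' y' : ℕ → ℝ} {η M : ℝ}
    (hx : ∀ i < n, 0 ≤ x i ∧ x i ≤ M) (hy : ∀ i < n, 0 ≤ y i ∧ y i ≤ M)
    (hxy : ∀ i < n, ∀ l < N, u i ≤ w l → w (l + 1) ≤ u (i + 1) →
      |x' l - x i| ≤ η ∧ |y' l - y i| ≤ η) :
    |weightedSum x' y' f N w - weightedSum x y f n u| ≤
      η * varSum f N w + M * (varSum f N w - varSum f n u) := by
  obtain ⟨j, hj, hjm⟩ := exists_index hu hw hsub
  have hj0 : j 0 = 0 := by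
    by_contra h
    exact (hj 0 (Nat.zero_le _)).2.2 0 (Nat.pos_of_ne_zero h) h0.symm
  have hjn : j n = N := by
    by_contra h
    have hlt : j n < N := lt_of_le_of_ne (hj n le_rfl).1 h
    have := (hws _ hlt).trans_le (hw hlt)
    rw [(hj n le_rfl).2.1, hN] at this
    exact lt_irrefl _ this
  have hblock : ∀ g : ℕ → ℝ, ∑ l ∈ Finset.range N, g l =
      ∑ i ∈ Finset.range n, ∑ l ∈ Finset.Ico (j i) (j (i + 1)), g l := by
    intro g
    rw [(sum_blocks g j n hjm).2, hj0, hjn, Finset.range_eq_Ico]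
  let d : ℕ → ℝ := fun l => f (w (l + 1)) - f (w l)
  have hd : ∀ i < n, f (u (i + 1)) - f (u i) = ∑ l ∈ Finset.Ico (j i) (j (i + 1)), d l := by
    intro i hi
    rw [← (hj i hi.le).2.1, ← (hj (i + 1) hi).2.1,
      ← Finset.sum_Ico_sub (fun l => f (w l)) (hjm i hi)]
  have e1 : weightedSum x' y' f N w - weightedSum x y f n u =
      ∑ i ∈ Finset.range n,
        ((∑ l ∈ Finset.Ico (j i) (j (i + 1)), x' l * max (d l) 0 -
            x i * max (∑ l ∈ Finset.Ico (j i) (j (i + 1)), d l) 0) +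
          (∑ l ∈ Finset.Ico (j i) (j (i + 1)), y' l * max (-d l) 0 -
            y i * max (∑ l ∈ Finset.Ico (j i) (j (i + 1)), -d l) 0)) := by
    rw [weightedSum, weightedSum, hblock, ← Finset.sum_sub_distrib]
    refine Finset.sum_congr rfl fun i hi => ?_
    rw [hd i (Finset.mem_range.1 hi), Finset.sum_add_distrib, Finset.sum_neg_distrib]
    ring
  -- Since a⁺ + a⁻ = |a|, the excesses of the positive and of the negative parts add up to the
  -- variation gained by refining.
  have e2 : η * varSum f N w + M * (varSum f N w - varSum f n u) =
      ∑ i ∈ Finset.range n,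
        ((η * ∑ l ∈ Finset.Ico (j i) (j (i + 1)), max (d l) 0 +
            M * (∑ l ∈ Finset.Ico (j i) (j (i + 1)), max (d l) 0 -
              max (∑ l ∈ Finset.Ico (j i) (j (i + 1)), d l) 0)) +
          (η * ∑ l ∈ Finset.Ico (j i) (j (i + 1)), max (-d l) 0 +
            M * (∑ l ∈ Finset.Ico (j i) (j (i + 1)), max (-d l) 0 -
              max (∑ l ∈ Finset.Ico (j i) (j (i + 1)), -d l) 0))) := by
    rw [varSum, varSum, hblock, ← Finset.sum_sub_distrib, Finset.mul_sum, Finset.mul_sum,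
      ← Finset.sum_add_distrib]
    refine Finset.sum_congr rfl fun i hi => ?_
    rw [hd i (Finset.mem_range.1 hi), Finset.sum_neg_distrib,
      ← max_add_max_neg (∑ l ∈ Finset.Ico (j i) (j (i + 1)), d l),
      Finset.sum_congr rfl fun l _ => (max_add_max_neg (d l)).symm, Finset.sum_add_distrib]
    ring
  rw [e1, e2]
  refine (Finset.abs_sum_le_sum_abs _ _).trans (Finset.sum_le_sum fun i hi => ?_)
  have hi' := Finset.mem_range.1 hi
  have hl : ∀ l ∈ Finset.Ico (j i) (j (i + 1)), |x' l - x i| ≤ η ∧ |y' l - y i| ≤ η := by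
    intro l hl
    rw [Finset.mem_Ico] at hl
    refine hxy i hi' l (hl.2.trans_le (hj (i + 1) hi').1) ?_ ?_
    · rw [← (hj i hi'.le).2.1]; exact hw hl.1
    · rw [← (hj (i + 1) hi').2.1]; exact hw hl.2
  exact (abs_add_le _ _).trans (add_le_add
    (abs_sum_mul_max_sub_le _ x' d (hx i hi').1 (hx i hi').2 fun l h => (hl l h).1)
    (abs_sum_mul_max_sub_le _ y' (fun l => -d l) (hy i hi').1 (hy i hi').2 fun l h => (hl l h).2))

theorem varSum_le_eVariationOn {f : ι → ℝ} {s : Set ι} (hf : BoundedVariationOn f s) {u : ℕ → ι}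
    (hu : Monotone u) (hs : ∀ i, u i ∈ s) (n : ℕ) :
    varSum f n u ≤ (eVariationOn f s).toReal := by
  have h := eVariationOn.sum_le (f := f) (n := n) hu hs
  have h2 : ENNReal.ofReal (varSum f n u) ≤ eVariationOn f s := by
    rw [varSum, ENNReal.ofReal_sum_of_nonneg fun _ _ => abs_nonneg _]
    simpa only [edist_dist, Real.dist_eq] using h
  exact (ENNReal.ofReal_le_iff_le_toReal hf).1 h2

theorem exists_varSum_gt {f : ι → ℝ} {s : Set ι} {r : ℝ} (hr : 0 ≤ r)
    (h : ENNReal.ofReal r < eVariationOn f s) :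
    ∃ (n : ℕ) (u : ℕ → ι), Monotone u ∧ (∀ i, u i ∈ s) ∧ r < varSum f n u := by
  obtain ⟨⟨n, u, hu, hs⟩, hlt⟩ := lt_iSup_iff.1 h
  refine ⟨n, u, hu, hs, ?_⟩
  have h2 : ENNReal.ofReal r < ENNReal.ofReal (varSum f n u) := by
    rw [varSum, ENNReal.ofReal_sum_of_nonneg fun _ _ => abs_nonneg _]
    simpa only [edist_dist, Real.dist_eq] using hlt
  exact (ENNReal.ofReal_lt_ofReal_iff_of_nonneg hr).1 h2

theorem eVariationOn_le_of_varSum_le {f : ι → ℝ} {s : Set ι} {r : ℝ} (hr : 0 ≤ r)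
    (h : ∀ (n : ℕ) (u : ℕ → ι), Monotone u → (∀ i, u i ∈ s) → varSum f n u ≤ r) :
    eVariationOn f s ≤ ENNReal.ofReal r := by
  by_contra hlt
  obtain ⟨n, u, hu, hs, hgt⟩ := exists_varSum_gt hr (not_le.1 hlt)
  exact absurd (h n u hu hs) (not_le.2 hgt)

/-- The points of a partition as a sequence, constant from the last point on. -/
def IntervalPartition.chain {a b : ι} (P : IntervalPartition a b) (k : ℕ) : ι :=
  P.t ⟨min k P.n, Nat.lt_succ_of_le (min_le_right _ _)⟩

section

variable {a b : ι} (P : IntervalPartition a b)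

theorem IntervalPartition.chain_mono : Monotone P.chain := fun i j hij =>
  P.mono (by simpa [Fin.le_def] using Or.inl hij)

theorem IntervalPartition.chain_zero : P.chain 0 = a :=
  (congrArg P.t (Fin.ext (by simp))).trans P.first

theorem IntervalPartition.chain_last : P.chain P.n = b :=
  (congrArg P.t (Fin.ext (by simp))).trans P.last

theorem IntervalPartition.chain_fin (i : Fin (P.n + 1)) : P.chain i = P.t i :=
  congrArg P.t (Fin.ext (by simpa using Nat.le_of_lt_succ i.2))

theorem IntervalPartition.chain_mem (k : ℕ) : P.chain k ∈ Icc a b :=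
  ⟨P.first.symm.le.trans (P.mono (Fin.zero_le _)), (P.mono (Fin.le_last _)).trans P.last.le⟩

variable {P}

theorem IntervalPartition.IsSubdivision.exists_chain {s : Fin P.n → ι} (hs : P.IsSubdivision s) :
    ∃ c : ℕ → ι, (∀ l < P.n, P.chain l ≤ c l ∧ c l < P.chain (l + 1)) ∧
      ∀ bid S ask φ : ι → ℝ, riemannSum bid S ask φ P s =
        weightedSum (fun l => ask (c l) - S (c l)) (fun l => S (c l) - bid (c l)) φ P.n
          P.chain := by
  have hc : ∀ i : Fin P.n, P.chain i = P.t i.castSucc ∧ P.chain (i + 1) = P.t i.succ :=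
    fun i => ⟨P.chain_fin i.castSucc, P.chain_fin i.succ⟩
  refine ⟨fun l => if h : l < P.n then s ⟨l, h⟩ else a, fun l hl => ?_, fun bid S ask φ => ?_⟩
  · have := hs ⟨l, hl⟩
    rw [← (hc ⟨l, hl⟩).1, ← (hc ⟨l, hl⟩).2] at this
    simpa only [dif_pos hl] using this
  · rw [weightedSum, Finset.sum_range, riemannSum, ← Finset.sum_add_distrib]
    refine Finset.sum_congr rfl fun i _ => ?_
    simp only [(hc i).1, (hc i).2, Fin.is_lt, dite_true, Fin.eta]

theorem IntervalPartition.IsSubdivision.chain_lt {s : Fin P.n → ι} (hs : P.IsSubdivision s) :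
    ∀ l < P.n, P.chain l < P.chain (l + 1) := by
  obtain ⟨c, hc, -⟩ := hs.exists_chain
  exact fun l hl => (hc l hl).1.trans_lt (hc l hl).2

end

/-- The partition of `[a, b]` with the points `u 0, …, u n`. -/
def IntervalPartition.ofChain {a b : ι} (n : ℕ) (u : ℕ → ι) (hu : Monotone u) (h0 : u 0 = a)
    (hn : u n = b) : IntervalPartition a b where
  n := n
  t i := u i
  mono _ _ hij := hu hij
  first := h0
  last := hn

theorem IntervalPartition.Refines.exists_chain {a b : ι} {P Q : IntervalPartition a b}
    (h : P.Refines Q) (i : Fin (Q.n + 1)) : ∃ l ≤ P.n, P.chain l = Q.t i := by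
  obtain ⟨k, hk⟩ := h ⟨i, rfl⟩
  exact ⟨k, Nat.le_of_lt_succ k.2, by rw [P.chain_fin, hk]⟩

theorem IntervalPartition.Refines.trans {a b : ι} {P Q R : IntervalPartition a b}
    (h : P.Refines Q) (h' : Q.Refines R) : P.Refines R := Subset.trans h' h

/-- There is a partition of `[a, b]` that contains given points. -/
theorem exists_partition_of_finset {a b : ι} (hab : a ≤ b) (F : Finset ι) :
    ∃ P : IntervalPartition a b, ∀ x ∈ F, x ∈ Icc a b → x ∈ range P.t := by
  classical
  let G : Finset ι := insert a (insert b (F.filter fun x => x ∈ Icc a b))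
  have hG : ∀ x ∈ G, a ≤ x ∧ x ≤ b := by
    intro x hx
    simp only [G, Finset.mem_insert, Finset.mem_filter] at hx
    rcases hx with rfl | rfl | hx
    exacts [⟨le_rfl, hab⟩, ⟨hab, le_rfl⟩, hx.2]
  have haG : a ∈ G := Finset.mem_insert_self _ _
  have hbG : b ∈ G := Finset.mem_insert_of_mem (Finset.mem_insert_self _ _)
  obtain ⟨n, hn⟩ : ∃ n, G.card = n + 1 :=
    Nat.exists_eq_succ_of_ne_zero (Finset.card_ne_zero_of_mem haG)
  let e := G.orderEmbOfFin hn
  have he : Set.range e = (G : Set ι) := G.range_orderEmbOfFin hn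
  have hmem : ∀ x ∈ G, ∃ i, e i = x := fun x hx => by
    have : x ∈ Set.range e := he ▸ hx
    exact this
  have hmem' : ∀ i, e i ∈ G := fun i => G.orderEmbOfFin_mem hn i
  refine ⟨⟨n, e, e.monotone, ?_, ?_⟩, fun x hx hxI => ?_⟩
  · obtain ⟨i, hi⟩ := hmem a haG
    exact le_antisymm (hi ▸ e.monotone (Fin.zero_le i)) (hG _ (hmem' _)).1
  · obtain ⟨i, hi⟩ := hmem b hbG
    exact le_antisymm (hG _ (hmem' _)).2 (hi ▸ e.monotone (Fin.le_last i))
  · exact hmem x (Finset.mem_insert_of_mem (Finset.mem_insert_of_mem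
      (Finset.mem_filter.2 ⟨hx, hxI⟩)))

end Chains

/-! ### Càdlàg paths are regulated -/

section Regulated

variable {ι : Type*} [LinearOrder ι]

/-- The oscillation of `X` is at most `η` on each interval `[u, v]` such that `]u, v]` avoids
`F`. -/
def OscLE (X : ι → ℝ) (F : Finset ι) (η : ℝ) : Prop :=
  ∀ u v, u ≤ v → (∀ x ∈ F, u < x → v < x) → |X u - X v| ≤ η

/-- Functions that are, up to any error, piecewise constant on finitely many half-open
intervals. -/
def IsRegulated (X : ι → ℝ) : Prop := ∀ η > 0, ∃ F : Finset ι, OscLE X F η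

theorem OscLE.mono {X : ι → ℝ} {F G : Finset ι} {η : ℝ} (h : OscLE X F η) (hFG : F ⊆ G) :
    OscLE X G η := fun u v huv hG => h u v huv fun x hx => hG x (hFG hx)

theorem IsRegulated.sub {X Y : ι → ℝ} (hX : IsRegulated X) (hY : IsRegulated Y) :
    IsRegulated fun t => X t - Y t := by
  classical
  intro η hη
  obtain ⟨F, hF⟩ := hX (η / 2) (by positivity)
  obtain ⟨G, hG⟩ := hY (η / 2) (by positivity)
  refine ⟨F ∪ G, fun u v huv h => ?_⟩
  have h1 := hF.mono (Finset.subset_union_left (s₂ := G)) u v huv h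
  have h2 := hG.mono (Finset.subset_union_right (s₁ := F)) u v huv h
  rw [abs_le] at *
  constructor <;> linarith

theorem IsRegulated.exists_bound [OrderBot ι] {X : ι → ℝ} (hX : IsRegulated X) :
    ∃ M, 0 ≤ M ∧ ∀ t, |X t| ≤ M := by
  classical
  obtain ⟨F, hF⟩ := hX 1 one_pos
  refine ⟨∑ x ∈ insert ⊥ F, |X x| + 1,
    add_nonneg (Finset.sum_nonneg fun _ _ => abs_nonneg _) zero_le_one, fun t => ?_⟩
  let G := (insert ⊥ F).filter fun x => x ≤ t
  have hne : G.Nonempty := ⟨⊥, Finset.mem_filter.2 ⟨Finset.mem_insert_self _ _, bot_le⟩⟩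
  have hm := Finset.mem_filter.1 (G.max'_mem hne)
  have h1 := hF (G.max' hne) t hm.2 fun x hx hlt => by
    by_contra h
    exact not_le.2 hlt (G.le_max' x (Finset.mem_filter.2
      ⟨Finset.mem_insert_of_mem hx, not_lt.1 h⟩))
  have h2 := Finset.single_le_sum (f := fun x => |X x|) (fun _ _ => abs_nonneg _) hm.1
  have h3 : |X t| - |X (G.max' hne)| ≤ |X t - X (G.max' hne)| := abs_sub_abs_le_abs_sub _ _
  rw [abs_sub_comm] at h3
  linarith

theorem IsCadlag.isRegulated [TopologicalSpace ι] [OrderTopology ι] [CompactSpace ι]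
    {X : ι → ℝ} (hX : IsCadlag X) : IsRegulated X := by
  classical
  intro η hη
  have key : ∃ F : Finset ι, ∀ u ∈ (univ : Set ι), ∀ v, u ≤ v → (∀ x ∈ F, u < x → v < x) →
      |X u - X v| ≤ η := by
    -- Only the left endpoint u is localized, so that the property passes to unions. Near x, the
    -- point x itself is put into F to separate the regime of the left limit from that of right
    -- continuity.
    refine isCompact_univ.induction_on (p := fun s => ∃ F : Finset ι, ∀ u ∈ s, ∀ v, u ≤ v →
      (∀ x ∈ F, u < x → v < x) → |X u - X v| ≤ η) ⟨∅, fun u hu => absurd hu (notMem_empty u)⟩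
      (fun s t hst ⟨F, hF⟩ => ⟨F, fun u hu => hF u (hst hu)⟩) ?_ ?_
    · rintro s t ⟨F, hF⟩ ⟨G, hG⟩
      refine ⟨F ∪ G, fun u hu v huv h => ?_⟩
      rcases hu with hu | hu
      · exact hF u hu v huv fun x hx => h x (Finset.mem_union_left _ hx)
      · exact hG u hu v huv fun x hx => h x (Finset.mem_union_right _ hx)
    · intro x _
      obtain ⟨hr, l, hl⟩ := hX x
      have hr' : ∀ᶠ u in 𝓝[≥] x, |X u - X x| < η / 2 := by
        have := hr.eventually (Metric.ball_mem_nhds _ (half_pos hη))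
        simpa only [Metric.mem_ball, Real.dist_eq] using this
      have hl' : ∀ᶠ u in 𝓝[<] x, |X u - l| < η / 2 := by
        have := hl.eventually (Metric.ball_mem_nhds _ (half_pos hη))
        simpa only [Metric.mem_ball, Real.dist_eq] using this
      obtain ⟨R, hRx, hR⟩ : ∃ R : Finset ι, (∀ r ∈ R, x < r) ∧ ∀ u, x ≤ u → (∀ r ∈ R, u < r) →
          |X u - X x| < η / 2 := by
        by_cases h : ∃ y, x < y
        · obtain ⟨y, hy⟩ := h
          obtain ⟨r, hr0, hr⟩ := (mem_nhdsGE_iff_exists_mem_Ioc_Ico_subset hy).1 hr'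
          exact ⟨{r}, by simpa using hr0.1, fun u hu hur => hr ⟨hu, hur r (Finset.mem_singleton_self r)⟩⟩
        · refine ⟨∅, by simp, fun u hu _ => ?_⟩
          have : u = x := le_antisymm (not_lt.1 fun h' => h ⟨u, h'⟩) hu
          rw [this]; simpa using half_pos hη
      obtain ⟨U, hU, hUl⟩ : ∃ U ∈ 𝓝 x, ∀ u ∈ U, ∀ v, u ≤ v → v < x → |X v - l| < η / 2 := by
        by_cases h : ∃ y, y < x
        · obtain ⟨y, hy⟩ := h
          obtain ⟨r, hr, hr2⟩ := (mem_nhdsLT_iff_exists_mem_Ico_Ioo_subset hy).1 hl'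
          exact ⟨Ioi r, Ioi_mem_nhds hr.2, fun u hu v huv hv =>
            hr2 ⟨lt_of_lt_of_le hu huv, hv⟩⟩
        · exact ⟨univ, univ_mem, fun u _ v _ hv => absurd ⟨v, hv⟩ h⟩
      obtain ⟨V, hV, hVR⟩ : ∃ V ∈ 𝓝 x, ∀ u ∈ V, x ≤ u → |X u - X x| < η / 2 ∧
          ∀ r ∈ R, u < r := by
        have h2 : ∀ᶠ u in 𝓝 x, ∀ r ∈ R, u < r :=
          (Finset.eventually_all R).2 fun r hr => Iio_mem_nhds (hRx r hr)
        rw [eventually_nhdsWithin_iff] at hr'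
        exact ⟨_, hr'.and h2, fun u hu hxu => ⟨hu.1 hxu, hu.2⟩⟩
      refine ⟨U ∩ V, mem_nhdsWithin_of_mem_nhds (inter_mem hU hV), insert x R, ?_⟩
      rintro u ⟨huU, huV⟩ v huv hno
      have hclose : ∀ p q c : ℝ, |p - c| < η / 2 → |q - c| < η / 2 → |p - q| ≤ η := by
        intro p q c hp hq
        rw [abs_lt] at hp hq
        rw [abs_le]; constructor <;> linarith
      rcases lt_or_ge u x with hux | hux
      · have hvx := hno x (Finset.mem_insert_self _ _) hux
        exact hclose _ _ l (hUl u huU u le_rfl hux) (hUl u huU v huv hvx)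
      · obtain ⟨h1, h2⟩ := hVR u huV hux
        exact hclose _ _ (X x) h1 (hR v (hux.trans huv) fun r hr =>
          hno r (Finset.mem_insert_of_mem hr) (h2 r hr))
  obtain ⟨F, hF⟩ := key
  exact ⟨F, fun u v => hF u (mem_univ _) v⟩

instance (T : ℝ≥0) : CompactSpace (Time T) := by
  have : IsCompact (Set.Iic T) := by
    rw [← Icc_bot]; exact isCompact_Icc
  exact isCompact_iff_compactSpace.1 this

end Regulated

/-! ### Existence of the cost term for bounded variation -/

section Cost

variable {ι : Type*} [LinearOrder ι] {a b : ι}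

/-- The points `u 0, …, u n` comprise all points of `F` in `[a, b]`. -/
def Visits (F : Finset ι) (a b : ι) (n : ℕ) (u : ℕ → ι) : Prop :=
  ∀ x ∈ F, x ∈ Icc a b → ∃ l ≤ n, u l = x

theorem Visits.mono {F G : Finset ι} {n : ℕ} {u : ℕ → ι} (h : Visits G a b n u) (hFG : F ⊆ G) :
    Visits F a b n u := fun x hx => h x (hFG hx)

/-- No point of F lies strictly between consecutive chain points. This is where half-open cells
matter: a jump at the right endpoint is never sampled. -/
theorem Visits.abs_sub_le {F : Finset ι} {n : ℕ} {u : ℕ → ι} (h : Visits F a b n u)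
    (hu : Monotone u) (h0 : u 0 = a) (hn : u n = b) {X : ι → ℝ} {η : ℝ} (hX : OscLE X F η) {i : ℕ}
    (hi : i < n) {v : ι} (hv : u i ≤ v) (hv' : v < u (i + 1)) : |X v - X (u i)| ≤ η := by
  rw [abs_sub_comm]
  refine hX _ _ hv fun x hx hlt => ?_
  by_contra hvx
  have hxI : x ∈ Icc a b := by
    refine ⟨?_, ?_⟩
    · rw [← h0]; exact (hu (Nat.zero_le i)).trans hlt.le
    · rw [← hn]; exact (not_lt.1 hvx).trans (hv'.le.trans (hu hi))
  obtain ⟨k, -, rfl⟩ := h x hx hxI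
  have h1 : i < k := hu.reflect_lt hlt
  have h2 : k < i + 1 := hu.reflect_lt ((not_lt.1 hvx).trans_lt hv')
  omega

theorem exists_chain_visits (hab : a ≤ b) (F : Finset ι) :
    ∃ (n : ℕ) (u : ℕ → ι), Monotone u ∧ u 0 = a ∧ u n = b ∧ (∀ i, u i ∈ Icc a b) ∧
      Visits F a b n u := by
  obtain ⟨P, hP⟩ := exists_partition_of_finset hab F
  refine ⟨P.n, P.chain, P.chain_mono, P.chain_zero, P.chain_last, P.chain_mem, fun x hx hxI => ?_⟩
  obtain ⟨i, rfl⟩ := hP x hx hxI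
  exact ⟨i, Nat.le_of_lt_succ i.2, P.chain_fin i⟩

theorem exists_finset_varSum_ge {f : ι → ℝ} (hf : BoundedVariationOn f (Icc a b)) {θ : ℝ}
    (hθ : 0 < θ) :
    ∃ F : Finset ι, ∀ (n : ℕ) (w : ℕ → ι), Monotone w → Visits F a b n w →
      (eVariationOn f (Icc a b)).toReal - θ ≤ varSum f n w := by
  classical
  set V := (eVariationOn f (Icc a b)).toReal
  rcases lt_or_ge (V - θ) 0 with h | h
  · exact ⟨∅, fun n w _ _ => h.le.trans (varSum_nonneg _ _ _)⟩
  · obtain ⟨n, u, hu, hs, hgt⟩ := exists_varSum_gt (f := f) (s := Icc a b) h (by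
      rw [← ENNReal.ofReal_toReal hf]
      exact (ENNReal.ofReal_lt_ofReal_iff_of_nonneg h).2 (by linarith))
    refine ⟨(Finset.range (n + 1)).image u, fun N w hw hv => hgt.le.trans ?_⟩
    refine varSum_le_of_subset hu hw fun i hi => ?_
    exact hv (u i) (Finset.mem_image_of_mem u (Finset.mem_range.2 (Nat.lt_succ_of_le hi))) (hs i)

theorem IntervalPartition.Refines.visits {n : ℕ} {u : ℕ → ι} {hu : Monotone u} {h0 : u 0 = a}
    {hn : u n = b} {P : IntervalPartition a b}
    (h : P.Refines (IntervalPartition.ofChain n u hu h0 hn)) :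
    ∀ i ≤ n, ∃ l ≤ P.n, P.chain l = u i := fun i hi =>
  h.exists_chain ⟨i, Nat.lt_succ_of_le hi⟩

/-- The variation along P is replaced by the total variation, which makes the bound independent of
the refinement P. The weights x, y need not be prices at the chain points, which later allows
stopped chains. -/
theorem abs_riemannSum_sub_weightedSum_le {bid S ask f : ι → ℝ}
    (hf : BoundedVariationOn f (Icc a b)) {M η : ℝ} (hη : 0 ≤ η) (hM : 0 ≤ M) {n : ℕ} {u : ℕ → ι}
    {hu : Monotone u} {h0 : u 0 = a} {hn : u n = b} {x y : ℕ → ℝ}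
    (hx : ∀ i < n, 0 ≤ x i ∧ x i ≤ M) (hy : ∀ i < n, 0 ≤ y i ∧ y i ≤ M)
    (hxy : ∀ i < n, ∀ v, u i ≤ v → v < u (i + 1) →
      |ask v - S v - x i| ≤ η ∧ |S v - bid v - y i| ≤ η)
    {P : IntervalPartition a b} (hP : P.Refines (IntervalPartition.ofChain n u hu h0 hn))
    {s : Fin P.n → ι} (hs : P.IsSubdivision s) :
    |riemannSum bid S ask f P s - weightedSum x y f n u| ≤
      η * (eVariationOn f (Icc a b)).toReal +
        M * ((eVariationOn f (Icc a b)).toReal - varSum f n u) := by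
  obtain ⟨c, hc, hR⟩ := hs.exists_chain
  have hV := varSum_le_eVariationOn hf P.chain_mono P.chain_mem P.n
  rw [hR]
  refine (abs_weightedSum_sub_le (η := η) (M := M) hu P.chain_mono hs.chain_lt hP.visits
    (h0.trans P.chain_zero.symm) (hn.trans P.chain_last.symm) hx hy
    fun i hi l hl h1 h2 => ?_).trans ?_
  · exact hxy i hi (c l) (h1.trans (hc l hl).1) ((hc l hl).2.trans_le h2)
  · gcongr

/-- A path of bounded variation has a finite cost term; it is close to the weighted sums along
chains on which the prices oscillate little and which nearly exhaust the variation. -/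
theorem exists_hasCostTerm {bid S ask f : ι → ℝ} (hab : a ≤ b)
    (hX : IsRegulated fun t => ask t - S t) (hY : IsRegulated fun t => S t - bid t) {M : ℝ}
    (hXM : ∀ t, 0 ≤ ask t - S t ∧ ask t - S t ≤ M) (hYM : ∀ t, 0 ≤ S t - bid t ∧ S t - bid t ≤ M)
    (hf : BoundedVariationOn f (Icc a b)) :
    ∃ c : ℝ≥0, HasCostTerm bid S ask f a b c ∧
      ∀ (n : ℕ) (u : ℕ → ι) (x y : ℕ → ℝ) (η : ℝ), Monotone u → u 0 = a → u n = b → 0 ≤ η →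
        (∀ i < n, 0 ≤ x i ∧ x i ≤ M) → (∀ i < n, 0 ≤ y i ∧ y i ≤ M) →
        (∀ i < n, ∀ v, u i ≤ v → v < u (i + 1) →
          |ask v - S v - x i| ≤ η ∧ |S v - bid v - y i| ≤ η) →
        |(c : ℝ) - weightedSum x y f n u| ≤ η * (eVariationOn f (Icc a b)).toReal +
          M * ((eVariationOn f (Icc a b)).toReal - varSum f n u) := by
  classical
  have hM : 0 ≤ M := (hXM a).1.trans (hXM a).2
  set V := (eVariationOn f (Icc a b)).toReal with hVdef
  have hV : 0 ≤ V := ENNReal.toReal_nonneg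
  let θ : ℕ → ℝ := fun k => 1 / ((k : ℝ) + 1)
  have hθ : ∀ k, 0 < θ k := fun k => Nat.one_div_pos_of_nat
  have hθlim : Tendsto θ atTop (𝓝 0) := tendsto_one_div_add_atTop_nhds_zero_nat
  have hex : ∀ k, ∃ (n : ℕ) (u : ℕ → ι), ∃ (hu : Monotone u) (h0 : u 0 = a) (hn : u n = b),
      ∀ P : IntervalPartition a b, P.Refines (IntervalPartition.ofChain n u hu h0 hn) →
        ∀ s, P.IsSubdivision s → |riemannSum bid S ask f P s -
          weightedSum (fun i => ask (u i) - S (u i)) (fun i => S (u i) - bid (u i)) f n u| ≤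
          θ k * V + M * θ k := by
    intro k
    obtain ⟨F₁, h1⟩ := hX (θ k) (hθ k)
    obtain ⟨F₂, h2⟩ := hY (θ k) (hθ k)
    obtain ⟨F₃, h3⟩ := exists_finset_varSum_ge hf (hθ k)
    obtain ⟨n, u, hu, h0, hn, hmem, hv⟩ := exists_chain_visits hab (F₁ ∪ (F₂ ∪ F₃))
    have hv1 := hv.mono Finset.subset_union_left
    have hv23 := hv.mono Finset.subset_union_right
    have hv2 := hv23.mono Finset.subset_union_left
    have hv3 := hv23.mono Finset.subset_union_right
    refine ⟨n, u, hu, h0, hn, fun P hP s hs => ?_⟩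
    refine (abs_riemannSum_sub_weightedSum_le hf (hθ k).le hM (fun i _ => hXM (u i))
      (fun i _ => hYM (u i)) (fun i hi v hv hv' => ⟨hv1.abs_sub_le hu h0 hn h1 hi hv hv',
        hv2.abs_sub_le hu h0 hn h2 hi hv hv'⟩) hP hs).trans ?_
    have := h3 n u hu hv3
    gcongr
    linarith
  choose n u hu h0 hn hR using hex
  let R : ℕ → ℝ := fun k =>
    weightedSum (fun i => ask (u k i) - S (u k i)) (fun i => S (u k i) - bid (u k i)) f (n k) (u k)
  let e : ℕ → ℝ := fun k => θ k * V + M * θ k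
  have he : Tendsto e atTop (𝓝 0) := by
    have := (hθlim.mul_const V).add (hθlim.const_mul M)
    simpa using this
  have heanti : ∀ k l, k ≤ l → e l ≤ e k := by
    intro k l hkl
    have : θ l ≤ θ k := Nat.one_div_le_one_div hkl
    simp only [e]
    gcongr
  -- Both sums are close to one Riemann sum along a common refinement; hence `R` is Cauchy and its
  -- limit is the cost.
  have hcompare : ∀ k l, |R k - R l| ≤ e k + e l := by
    intro k l
    obtain ⟨Q, hQ1, hQ2, s, hs⟩ := IntervalPartition.exists_common
      (IntervalPartition.ofChain (n k) (u k) (hu k) (h0 k) (hn k))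
      (IntervalPartition.ofChain (n l) (u l) (hu l) (h0 l) (hn l))
    have h1 := hR k Q hQ1 s hs
    have h2 := hR l Q hQ2 s hs
    simp only [R, e]
    rw [abs_le] at *
    constructor <;> linarith
  have hcauchy : CauchySeq R := by
    refine cauchySeq_of_le_tendsto_0 (fun k => e k + e k) (fun p q N hp hq => ?_) (by
      simpa using he.add he)
    rw [Real.dist_eq]
    exact (hcompare p q).trans (add_le_add (heanti N p hp) (heanti N q hq))
  obtain ⟨c, hc⟩ := cauchySeq_tendsto_of_complete hcauchy
  have hR0 : ∀ k, 0 ≤ R k := fun k => Finset.sum_nonneg fun i _ =>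
    add_nonneg (mul_nonneg (hXM _).1 (le_max_right _ _)) (mul_nonneg (hYM _).1 (le_max_right _ _))
  have hc0 : 0 ≤ c := ge_of_tendsto' hc hR0
  have hRc : ∀ k, |R k - c| ≤ e k := by
    intro k
    have h1 : Tendsto (fun l => |R k - R l|) atTop (𝓝 |R k - c|) := (tendsto_const_nhds.sub hc).abs
    have h2 : Tendsto (fun l => e k + e l) atTop (𝓝 (e k + 0)) := tendsto_const_nhds.add he
    rw [add_zero] at h2
    exact le_of_tendsto_of_tendsto' h1 h2 (hcompare k)
  refine ⟨⟨c, hc0⟩, fun ε hε => ?_, fun N w x y η hw hw0 hwN hη hx hy hxy => ?_⟩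
  · obtain ⟨k, hk⟩ := (he.eventually_lt_const (half_pos hε)).exists
    refine ⟨IntervalPartition.ofChain (n k) (u k) (hu k) (h0 k) (hn k), fun P hP s hs =>
      ⟨fun _ => ?_, fun h => absurd h ENNReal.coe_ne_top⟩⟩
    have h1 := hR k P hP s hs
    have h2 := hRc k
    change |c - _| < ε
    simp only [R, e] at h2 hk
    rw [abs_le] at h1 h2
    rw [abs_lt]
    constructor <;> linarith
  · have key : ∀ k, |c - weightedSum x y f N w| ≤
        η * V + M * (V - varSum f N w) + (e k + e k) := by
      intro k
      obtain ⟨Q, hQ1, hQ2, s, hs⟩ := IntervalPartition.exists_common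
        (IntervalPartition.ofChain (n k) (u k) (hu k) (h0 k) (hn k))
        (IntervalPartition.ofChain N w hw hw0 hwN)
      have h1 := hR k Q hQ1 s hs
      have h2 := hRc k
      have h3 := abs_riemannSum_sub_weightedSum_le hf hη hM hx hy hxy hQ2 hs
      simp only [R, e] at h2 ⊢
      rw [abs_le] at *
      constructor <;> linarith
    have h2 : Tendsto (fun k => η * V + M * (V - varSum f N w) + (e k + e k)) atTop
        (𝓝 (η * V + M * (V - varSum f N w) + (0 + 0))) := tendsto_const_nhds.add (he.add he)
    rw [add_zero, add_zero] at h2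
    exact ge_of_tendsto' h2 key

end Cost

/-! ### Finite cost implies bounded variation -/

section Variation

variable {ι : Type*} [LinearOrder ι] {a b : ι}

/-- On a coarse cell where buying costs at least κ, write |d| = 2d⁺ − d: the first term is at most
2/κ times the cost, and the second telescopes to the coarse increment. Where selling is costly, use
|d| = 2d⁻ + d. -/
theorem varSum_le_weightedSum_add {f : ι → ℝ} {u w : ℕ → ι} {n N : ℕ} (hu : Monotone u)
    (hw : Monotone w) (hws : ∀ l < N, w l < w (l + 1)) (hsub : ∀ i ≤ n, ∃ l ≤ N, w l = u i)
    (h0 : u 0 = w 0) (hN : u n = w N) {x y : ℕ → ℝ} {κ : ℝ} (hκ : 0 < κ)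
    (hx : ∀ l < N, 0 ≤ x l) (hy : ∀ l < N, 0 ≤ y l)
    (hxy : ∀ i < n, (∀ l < N, u i ≤ w l → w (l + 1) ≤ u (i + 1) → κ ≤ x l) ∨
      ∀ l < N, u i ≤ w l → w (l + 1) ≤ u (i + 1) → κ ≤ y l) :
    varSum f N w ≤ 2 / κ * weightedSum x y f N w + varSum f n u := by
  obtain ⟨j, hj, hjm⟩ := exists_index hu hw hsub
  have hj0 : j 0 = 0 := by
    by_contra h
    exact (hj 0 (Nat.zero_le _)).2.2 0 (Nat.pos_of_ne_zero h) h0.symm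
  have hjn : j n = N := by
    by_contra h
    have hlt : j n < N := lt_of_le_of_ne (hj n le_rfl).1 h
    have := (hws _ hlt).trans_le (hw hlt)
    rw [(hj n le_rfl).2.1, hN] at this
    exact lt_irrefl _ this
  have hblock : ∀ g : ℕ → ℝ, ∑ l ∈ Finset.range N, g l =
      ∑ i ∈ Finset.range n, ∑ l ∈ Finset.Ico (j i) (j (i + 1)), g l := by
    intro g
    rw [(sum_blocks g j n hjm).2, hj0, hjn, Finset.range_eq_Ico]
  rw [varSum, varSum, weightedSum, hblock, hblock, Finset.mul_sum, ← Finset.sum_add_distrib]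
  refine Finset.sum_le_sum fun i hi => ?_
  have hi' := Finset.mem_range.1 hi
  rw [← (hj i hi'.le).2.1, ← (hj (i + 1) hi').2.1,
    ← Finset.sum_Ico_sub (fun l => f (w l)) (hjm i hi')]
  set I := Finset.Ico (j i) (j (i + 1)) with hI
  let d : ℕ → ℝ := fun l => f (w (l + 1)) - f (w l)
  change ∑ l ∈ I, |d l| ≤ 2 / κ * ∑ l ∈ I, (x l * max (d l) 0 + y l * max (-(d l)) 0) +
    |∑ l ∈ I, d l|
  have hl : ∀ l ∈ I, l < N ∧ u i ≤ w l ∧ w (l + 1) ≤ u (i + 1) := by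
    intro l hl
    rw [hI, Finset.mem_Ico] at hl
    refine ⟨hl.2.trans_le (hj (i + 1) hi').1, ?_, ?_⟩
    · rw [← (hj i hi'.le).2.1]; exact hw hl.1
    · rw [← (hj (i + 1) hi').2.1]; exact hw hl.2
  have hpos : ∀ l ∈ I, 0 ≤ x l * max (d l) 0 ∧ 0 ≤ y l * max (-d l) 0 := fun l h =>
    ⟨mul_nonneg (hx l (hl l h).1) (le_max_right _ _),
      mul_nonneg (hy l (hl l h).1) (le_max_right _ _)⟩
  rcases hxy i hi' with hκx | hκy
  · have h1 : ∀ l ∈ I, |d l| ≤ 2 / κ * (x l * max (d l) 0 + y l * max (-d l) 0) - d l := by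
      intro l h
      have h2 : 2 / κ * (κ * max (d l) 0) ≤
          2 / κ * (x l * max (d l) 0 + y l * max (-d l) 0) := by
        have := mul_le_mul_of_nonneg_right (hκx l (hl l h).1 (hl l h).2.1 (hl l h).2.2)
          (le_max_right (d l) 0)
        have h3 := (hpos l h).2
        gcongr
        linarith
      have h4 : 2 / κ * (κ * max (d l) 0) = 2 * max (d l) 0 := by field_simp
      have h5 : |d l| = 2 * max (d l) 0 - d l := by
        rcases le_total 0 (d l) with h | h
        · rw [abs_of_nonneg h, max_eq_left h]; ring
        · rw [abs_of_nonpos h, max_eq_right h]; ring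
      linarith
    refine (Finset.sum_le_sum h1).trans ?_
    rw [Finset.sum_sub_distrib, ← Finset.mul_sum]
    linarith [neg_abs_le (∑ l ∈ I, d l)]
  · have h1 : ∀ l ∈ I, |d l| ≤ 2 / κ * (x l * max (d l) 0 + y l * max (-d l) 0) + d l := by
      intro l h
      have h2 : 2 / κ * (κ * max (-d l) 0) ≤
          2 / κ * (x l * max (d l) 0 + y l * max (-d l) 0) := by
        have := mul_le_mul_of_nonneg_right (hκy l (hl l h).1 (hl l h).2.1 (hl l h).2.2)
          (le_max_right (-d l) 0)
        have h3 := (hpos l h).1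
        gcongr
        linarith
      have h4 : 2 / κ * (κ * max (-d l) 0) = 2 * max (-d l) 0 := by field_simp
      have h5 : |d l| = 2 * max (-d l) 0 + d l := by
        rcases le_total 0 (d l) with h | h
        · rw [abs_of_nonneg h, max_eq_right (by linarith)]; ring
        · rw [abs_of_nonpos h, max_eq_left (by linarith)]; ring
      linarith
    refine (Finset.sum_le_sum h1).trans ?_
    rw [Finset.sum_add_distrib, ← Finset.mul_sum]
    linarith [le_abs_self (∑ l ∈ I, d l)]

/-- A path with a finite cost term has bounded variation if the spread is bounded away from
zero. -/
theorem HasCostTerm.boundedVariationOn {bid S ask f : ι → ℝ} (hab : a ≤ b)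
    (hX : IsRegulated fun t => ask t - S t) (hY : IsRegulated fun t => S t - bid t)
    (hX0 : ∀ t, S t ≤ ask t) (hY0 : ∀ t, bid t ≤ S t) {δ : ℝ} (hδ : 0 < δ)
    (hspread : ∀ t, a ≤ t → t < b → δ ≤ ask t - bid t) {c : ℝ≥0∞} (hc : c ≠ ∞)
    (h : HasCostTerm bid S ask f a b c) : BoundedVariationOn f (Icc a b) := by
  classical
  obtain ⟨P₀, hP₀⟩ := h 1 one_pos
  -- At the left end of a nondegenerate cell one of the two half-spreads is at least δ/2; an
  -- oscillation of at most δ/4 leaves δ/4 on the whole cell.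
  obtain ⟨F₁, h1⟩ := hX (δ / 4) (by positivity)
  obtain ⟨F₂, h2⟩ := hY (δ / 4) (by positivity)
  obtain ⟨n, u, hu, h0, hn, hmem, hv⟩ :=
    exists_chain_visits hab (F₁ ∪ (F₂ ∪ Finset.univ.image P₀.t))
  have hv1 := hv.mono Finset.subset_union_left
  have hv23 := hv.mono Finset.subset_union_right
  have hv2 := hv23.mono Finset.subset_union_left
  have hv3 := hv23.mono Finset.subset_union_right
  have hC : 0 ≤ 2 / (δ / 4) * (c.toReal + 1) + varSum f n u := by
    have := varSum_nonneg f n u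
    positivity
  refine ne_top_of_le_ne_top ENNReal.ofReal_ne_top (eVariationOn_le_of_varSum_le hC
    fun N w hw hwI => ?_)
  -- Refining the fixed chain `u` by the arbitrary chain `w` keeps the cost sum below c + 1, so the
  -- resulting bound does not depend on `w`.
  obtain ⟨R, hR⟩ := exists_partition_of_finset hab ((Finset.range (N + 1)).image w)
  obtain ⟨Q, hQu, hQR, s, hs⟩ := IntervalPartition.exists_common
    (IntervalPartition.ofChain n u hu h0 hn) R
  have hQP : Q.Refines P₀ := by
    refine hQu.trans ?_
    rintro _ ⟨i, rfl⟩
    obtain ⟨l, hl, hlu⟩ := hv3 (P₀.t i) (Finset.mem_image_of_mem _ (Finset.mem_univ i)) (by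
      rw [← P₀.chain_fin]; exact P₀.chain_mem _)
    exact ⟨⟨l, Nat.lt_succ_of_le hl⟩, hlu⟩
  have hcost := (hP₀ Q hQP s hs).1 hc
  obtain ⟨p, hp, hps⟩ := hs.exists_chain
  rw [hps] at hcost
  have hwQ : varSum f N w ≤ varSum f Q.n Q.chain := by
    refine varSum_le_of_subset hw Q.chain_mono fun i hi => ?_
    obtain ⟨k, hk⟩ := hR (w i) (Finset.mem_image_of_mem _ (Finset.mem_range.2
      (Nat.lt_succ_of_le hi))) (hwI i)
    rw [← hk]
    exact hQR.exists_chain k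
  refine hwQ.trans ((varSum_le_weightedSum_add (f := f) (κ := δ / 4) hu Q.chain_mono
    hs.chain_lt hQu.visits (h0.trans Q.chain_zero.symm) (hn.trans Q.chain_last.symm) (by positivity)
    (fun l _ => sub_nonneg.2 (hX0 (p l))) (fun l _ => sub_nonneg.2 (hY0 (p l)))
    fun i hi => ?_).trans ?_)
  · have hcell : ∀ l < Q.n, u i ≤ Q.chain l → Q.chain (l + 1) ≤ u (i + 1) →
        u i ≤ p l ∧ p l < u (i + 1) := fun l hl h1 h2 =>
      ⟨h1.trans (hp l hl).1, (hp l hl).2.trans_le h2⟩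
    rcases lt_or_ge (u i) (u (i + 1)) with hlt | hge
    · have hsp := hspread (u i) (hmem i).1 (hlt.trans_le (hmem _).2)
      rcases le_total (δ / 2) (ask (u i) - S (u i)) with hcase | hcase
      · refine Or.inl fun l hl hl1 hl2 => ?_
        obtain ⟨h3, h4⟩ := hcell l hl hl1 hl2
        have := hv1.abs_sub_le hu h0 hn h1 hi h3 h4
        rw [abs_le] at this
        linarith
      · refine Or.inr fun l hl hl1 hl2 => ?_
        obtain ⟨h3, h4⟩ := hcell l hl hl1 hl2
        have := hv2.abs_sub_le hu h0 hn h2 hi h3 h4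
        rw [abs_le] at this
        linarith
    · refine Or.inl fun l hl hl1 hl2 => ?_
      obtain ⟨h3, h4⟩ := hcell l hl hl1 hl2
      exact absurd (h3.trans_lt h4) (not_lt.2 hge)
  · rw [abs_lt] at hcost
    gcongr
    linarith

end Variation

/-! ### Uniform convergence of cost terms -/

section Uniform

variable {ι : Type*} [LinearOrder ι] {a b : ι}

theorem eVariationOn_Icc_add_Icc {f : ι → ℝ} {t : ι} (hat : a ≤ t) (htb : t ≤ b) :
    eVariationOn f (Icc a t) + eVariationOn f (Icc t b) = eVariationOn f (Icc a b) := by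
  simpa using eVariationOn.Icc_add_Icc f (s := univ) hat htb (mem_univ t)

/-- Split the chain at t: its part above t has at most the variation on [t, b], and variation is
additive over intervals. So one chain serves all t at once. -/
theorem variation_sub_varSum_min_le {f : ι → ℝ} (hf : BoundedVariationOn f (Icc a b)) {n : ℕ}
    {u : ℕ → ι} (hu : Monotone u) (hmem : ∀ i, u i ∈ Icc a b) {t : ι} (ht : t ∈ Icc a b) :
    (eVariationOn f (Icc a t)).toReal - varSum f n (fun i => min (u i) t) ≤
      (eVariationOn f (Icc a b)).toReal - varSum f n u := by
  have h1 : varSum f n u ≤ varSum f n (fun i => min (u i) t) + varSum f n fun i => max (u i) t := by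
    rw [varSum, varSum, varSum, ← Finset.sum_add_distrib]
    refine Finset.sum_le_sum fun i _ => ?_
    have hmm : ∀ x, f (min x t) + f (max x t) = f x + f t := by
      intro x
      rcases le_total x t with h | h
      · rw [min_eq_left h, max_eq_right h]
      · rw [min_eq_right h, max_eq_left h, add_comm]
    have : f (u (i + 1)) - f (u i) = (f (min (u (i + 1)) t) - f (min (u i) t)) +
        (f (max (u (i + 1)) t) - f (max (u i) t)) := by
      linarith [hmm (u i), hmm (u (i + 1))]
    rw [this]
    exact abs_add_le _ _
  have h2 : varSum f n (fun i => max (u i) t) ≤ (eVariationOn f (Icc t b)).toReal :=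
    varSum_le_eVariationOn (hf.mono (Icc_subset_Icc_left ht.1))
      (fun i j hij => max_le_max (hu hij) le_rfl)
      (fun i => ⟨le_max_right _ _, max_le (hmem i).2 ht.2⟩) n
  have h3 : (eVariationOn f (Icc a b)).toReal =
      (eVariationOn f (Icc a t)).toReal + (eVariationOn f (Icc t b)).toReal := by
    rw [← eVariationOn_Icc_add_Icc ht.1 ht.2, ENNReal.toReal_add]
    · exact hf.mono (Icc_subset_Icc_right ht.2)
    · exact hf.mono (Icc_subset_Icc_left ht.1)
  linarith

/-- Uniform approximation without increase of the variation makes the cost terms converge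
uniformly. -/
theorem costTerm_tendsto_uniformly [OrderBot ι] {bid S ask f : ι → ℝ} {ψ : ℕ → ι → ℝ} (hab : a ≤ b)
    (hX : IsRegulated fun t => ask t - S t) (hY : IsRegulated fun t => S t - bid t)
    (hX0 : ∀ t, S t ≤ ask t) (hY0 : ∀ t, bid t ≤ S t) (hf : BoundedVariationOn f (Icc a b))
    (hψ : ∀ k, eVariationOn (ψ k) (Icc a b) ≤ eVariationOn f (Icc a b)) {e : ℕ → ℝ}
    (he : Tendsto e atTop (𝓝 0)) (hψf : ∀ k, ∀ t ∈ Icc a b, |f t - ψ k t| ≤ e k) :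
    (∀ t ∈ Icc a b, costTerm bid S ask f a t < ∞) ∧
      (∀ k, ∀ t ∈ Icc a b, costTerm bid S ask (ψ k) a t < ∞) ∧
      ∀ ε > 0, ∀ᶠ k in atTop, ∀ t ∈ Icc a b,
        |(costTerm bid S ask f a t).toReal - (costTerm bid S ask (ψ k) a t).toReal| < ε := by
  obtain ⟨M₁, hM₁, hb₁⟩ := hX.exists_bound
  obtain ⟨M₂, hM₂, hb₂⟩ := hY.exists_bound
  set M := max M₁ M₂
  have hM : 0 ≤ M := hM₁.trans (le_max_left _ _)
  have hXM : ∀ t, 0 ≤ ask t - S t ∧ ask t - S t ≤ M := fun t =>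
    ⟨sub_nonneg.2 (hX0 t), (le_abs_self _).trans ((hb₁ t).trans (le_max_left _ _))⟩
  have hYM : ∀ t, 0 ≤ S t - bid t ∧ S t - bid t ≤ M := fun t =>
    ⟨sub_nonneg.2 (hY0 t), (le_abs_self _).trans ((hb₂ t).trans (le_max_right _ _))⟩
  have hψBV : ∀ k, BoundedVariationOn (ψ k) (Icc a b) := fun k => ne_top_of_le_ne_top hf (hψ k)
  have hfin : ∀ g : ι → ℝ, BoundedVariationOn g (Icc a b) → ∀ t ∈ Icc a b,
      costTerm bid S ask g a t < ∞ := by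
    intro g hg t ht
    obtain ⟨c, hc, -⟩ := exists_hasCostTerm ht.1 hX hY hXM hYM
      (hg.mono (Icc_subset_Icc_right ht.2))
    rw [hc.costTerm_eq]
    exact ENNReal.coe_lt_top
  refine ⟨hfin f hf, fun k => hfin (ψ k) (hψBV k), fun ε hε => ?_⟩
  set V := (eVariationOn f (Icc a b)).toReal with hVdef
  have hV : 0 ≤ V := ENNReal.toReal_nonneg
  classical
  set θ := ε / (4 * (V + M + 1)) with hθdef
  have hθ : 0 < θ := by positivity
  obtain ⟨F₁, h1⟩ := hX θ hθ
  obtain ⟨F₂, h2⟩ := hY θ hθ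
  obtain ⟨F₃, h3⟩ := exists_finset_varSum_ge hf hθ
  obtain ⟨n, u, hu, h0, hn, hmem, hv⟩ := exists_chain_visits hab (F₁ ∪ (F₂ ∪ F₃))
  have hv1 := hv.mono Finset.subset_union_left
  have hv23 := hv.mono Finset.subset_union_right
  have hv2 := hv23.mono Finset.subset_union_left
  have hv3 := h3 n u hu (hv23.mono Finset.subset_union_right)
  let x : ℕ → ℝ := fun i => ask (u i) - S (u i)
  let y : ℕ → ℝ := fun i => S (u i) - bid (u i)
  -- The chain is stopped at t but keeps the weights of the unstopped one; cells beyond t are empty,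
  -- and the right-hand side is free of t.
  have hest : ∀ g : ι → ℝ, BoundedVariationOn g (Icc a b) → ∀ t ∈ Icc a b,
      |(costTerm bid S ask g a t).toReal - weightedSum x y g n (fun i => min (u i) t)| ≤
        θ * (eVariationOn g (Icc a b)).toReal +
          M * ((eVariationOn g (Icc a b)).toReal - varSum g n u) := by
    intro g hg t ht
    obtain ⟨c, hc, hcest⟩ := exists_hasCostTerm ht.1 hX hY hXM hYM
      (hg.mono (Icc_subset_Icc_right ht.2))
    rw [hc.costTerm_eq]
    refine (hcest n (fun i => min (u i) t) x y θ (fun i j hij => min_le_min (hu hij) le_rfl)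
      (by simp [h0, ht.1]) (by simp [hn, ht.2]) hθ.le (fun i _ => hXM _) (fun i _ => hYM _)
      fun i hi v hv hv' => ?_).trans ?_
    · have hvt := hv'.trans_le (min_le_right _ _)
      have hv'' := hv'.trans_le (min_le_left _ _)
      have huv : u i ≤ v := (min_le_iff.1 hv).resolve_right (not_le.2 hvt)
      exact ⟨hv1.abs_sub_le hu h0 hn h1 hi huv hv'', hv2.abs_sub_le hu h0 hn h2 hi huv hv''⟩
    · have := variation_sub_varSum_min_le hg (n := n) hu hmem ht
      have h4 : (eVariationOn g (Icc a t)).toReal ≤ (eVariationOn g (Icc a b)).toReal :=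
        ENNReal.toReal_mono hg (eVariationOn.mono _ (Icc_subset_Icc_right ht.2))
      gcongr
  have hlim : Tendsto (fun k => (n : ℝ) * (M * (6 * e k))) atTop (𝓝 0) := by
    simpa using ((he.const_mul 6).const_mul M).const_mul (n : ℝ)
  filter_upwards [hlim.eventually_lt_const (half_pos hε)] with k hk t ht
  have e1 := hest f hf t ht
  have e2 := hest (ψ k) (hψBV k) t ht
  have e3 : |weightedSum x y f n (fun i => min (u i) t) -
      weightedSum x y (ψ k) n (fun i => min (u i) t)| ≤ n * (M * (4 * e k)) :=
    abs_weightedSum_sub_weightedSum_le (fun i _ => hXM _) (fun i _ => hYM _) fun i =>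
      hψf k _ ⟨le_min (hmem i).1 ht.1, (min_le_right _ _).trans ht.2⟩
  have e4 : varSum f n u - varSum (ψ k) n u ≤ n * (2 * e k) :=
    varSum_sub_le fun i => hψf k _ (hmem i)
  have e5 : (eVariationOn (ψ k) (Icc a b)).toReal ≤ V := ENNReal.toReal_mono hf (hψ k)
  -- Here Var ψₖ ≤ Var f is decisive: the chain, fixed before k, also nearly exhausts the variation
  -- of ψₖ.
  have e6 : θ * (eVariationOn (ψ k) (Icc a b)).toReal +
      M * ((eVariationOn (ψ k) (Icc a b)).toReal - varSum (ψ k) n u) ≤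
      θ * V + M * (θ + n * (2 * e k)) := by
    gcongr
    linarith
  have e7 : θ * V + M * (V - varSum f n u) ≤ θ * V + M * θ := by
    gcongr
    linarith
  have e8 : 2 * (θ * V + M * θ) ≤ ε / 2 := by
    have : θ * (4 * (V + M + 1)) = ε := by rw [hθdef]; field_simp
    nlinarith
  have e9 : M * (θ + n * (2 * e k)) + n * (M * (4 * e k)) = M * θ + n * (M * (6 * e k)) := by ring
  rw [abs_le] at e1 e2 e3
  rw [abs_lt]
  constructor <;> linarith

end Uniform

/-! ### Predictability of right limits at stopping times -/

section Predictable

variable {Ω : Type*} {m : MeasurableSpace Ω} {T : ℝ≥0} {𝓕 : Filtration (Time T) m}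

theorem measurableSet_predictable_lt {ρ : Ω → WithTop (Time T)} (hρ : IsStoppingTime 𝓕 ρ) :
    MeasurableSet[𝓕.predictable] {p : Time T × Ω | ρ p.2 < (p.1 : WithTop (Time T))} := by
  obtain ⟨D, hDc, hD⟩ := TopologicalSpace.exists_countable_dense (Time T)
  have : {p : Time T × Ω | ρ p.2 < (p.1 : WithTop (Time T))} =
      ⋃ q ∈ D, Ioi q ×ˢ {ω | ρ ω ≤ (q : WithTop (Time T))} := by
    ext ⟨t, ω⟩
    simp only [mem_ofPred_eq, mem_iUnion, mem_prod, mem_Ioi, exists_prop]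
    constructor
    · intro h
      induction hs : ρ ω with
      | top => rw [hs] at h; exact absurd h not_top_lt
      | coe s =>
        rw [hs] at h
        obtain ⟨q, hq, hsq, hqt⟩ := hD.exists_between (WithTop.coe_lt_coe.1 h)
        exact ⟨q, hq, hqt, WithTop.coe_le_coe.2 hsq.le⟩
    · rintro ⟨q, -, hqt, hq⟩
      exact hq.trans_lt (WithTop.coe_lt_coe.2 hqt)
  rw [this]
  exact MeasurableSet.biUnion hDc fun q _ => measurableSet_predictable_Ioi_prod (hρ q)

theorem measurableSet_predictable_le {ρ : Ω → WithTop (Time T)} (hρ : IsStoppingTime 𝓕 ρ) :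
    MeasurableSet[𝓕.predictable] {p : Time T × Ω | (p.1 : WithTop (Time T)) ≤ ρ p.2} := by
  convert (measurableSet_predictable_lt hρ).compl using 1
  ext p
  simp

theorem measurableSet_predictable_snd {N : Set Ω} (hN : MeasurableSet[𝓕 ⊥] N) :
    MeasurableSet[𝓕.predictable] {p : Time T × Ω | p.2 ∈ N} := by
  convert (measurableSet_predictable_singleton_bot_prod hN).union
    (measurableSet_predictable_Ioi_prod (𝓕 := 𝓕) hN) using 1
  ext ⟨t, ω⟩
  simp only [mem_ofPred_eq, mem_union, mem_prod, mem_singleton_iff, mem_Ioi, bot_lt_iff_ne_bot]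
  tauto

theorem measurable_predictable_indicator {q : Time T} {W : Ω → ℝ} (hW : Measurable[𝓕 q] W) :
    Measurable[𝓕.predictable] ((Ioi q ×ˢ (univ : Set Ω)).indicator fun p => W p.2) := by
  intro s hs
  have h1 := measurableSet_predictable_Ioi_prod (𝓕 := 𝓕) (hW hs)
  have h2 := measurableSet_predictable_Ioi_prod (𝓕 := 𝓕) (i := q) (MeasurableSet.univ)
  by_cases h0 : (0 : ℝ) ∈ s
  · convert h1.union h2.compl using 1
    ext p
    by_cases hp : p ∈ Ioi q ×ˢ (univ : Set Ω)
    · have := (mem_prod.1 hp).1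
      simp [hp, this]
    · rw [mem_preimage, indicator_of_notMem hp]
      simp [h0, hp]
  · convert h1 using 1
    ext p
    by_cases hp : p ∈ Ioi q ×ˢ (univ : Set Ω)
    · have := (mem_prod.1 hp).1
      simp [mem_Ioi.1 this]
    · rw [mem_preimage, indicator_of_notMem hp]
      simp only [h0, false_iff]
      exact fun h => hp ⟨h.1, mem_univ _⟩

/-- The process is sampled at the first point after ρ of the grid of mesh 1/(k+1) and the value is
used only after that point, when it is already known. As k grows, the sampling time decreases to ρ.
-/
theorem exists_measurable_delayed_value {φ : Time T → Ω → ℝ} (hφ : StronglyAdapted 𝓕 φ)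
    {ρ : Ω → WithTop (Time T)} (hρ : IsStoppingTime 𝓕 ρ) (k : ℕ) :
    ∃ Y : Time T × Ω → ℝ, Measurable[𝓕.predictable] Y ∧
      ∀ (ω : Ω) (s t : Time T), ρ ω = (s : WithTop (Time T)) →
        (s : ℝ≥0) + 1 / ((k : ℝ≥0) + 1) < t →
        ∃ q : Time T, s < q ∧ (q : ℝ≥0) ≤ s + 1 / ((k : ℝ≥0) + 1) ∧ Y (t, ω) = φ q ω := by
  let P : ℕ → Time T := fun j => ⟨min ((j : ℝ≥0) / (k + 1)) T, mem_Iic.2 (min_le_right _ _)⟩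
  have hPmono : Monotone P := fun i j hij => Subtype.mk_le_mk.2 (by gcongr)
  let E : ℕ → Set (Time T × Ω) := fun j => Ioi (P (j + 1)) ×ˢ
    {ω | (P j : WithTop (Time T)) ≤ ρ ω ∧ ρ ω < (P (j + 1) : WithTop (Time T))}
  have hE : ∀ j, MeasurableSet[𝓕.predictable] (E j) := fun j =>
    measurableSet_predictable_Ioi_prod
      ((𝓕.mono (hPmono j.le_succ) _ (hρ.measurableSet_ge (P j))).inter
        (hρ.measurableSet_lt (P (j + 1))))
  have hdisj : ∀ i j, i < j → Disjoint (E i) (E j) := by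
    intro i j hij
    refine disjoint_left.2 ?_
    rintro ⟨t, ω⟩ ⟨-, -, h1⟩ ⟨-, h2, -⟩
    exact absurd (h2.trans_lt h1) (not_lt.2 (WithTop.coe_le_coe.2 (hPmono hij)))
  obtain ⟨Y, hY, hYE⟩ := @exists_measurable_piecewise _ _ 𝓕.predictable _ ℕ _ _ E hE
    (fun j => (Ioi (P (j + 1)) ×ˢ (univ : Set Ω)).indicator fun p => φ (P (j + 1)) p.2)
    (fun j => measurable_predictable_indicator (hφ (P (j + 1))).measurable) (by
      intro i j hij p hp
      rcases lt_or_gt_of_ne hij with h | h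
      · exact absurd hp.2 (disjoint_left.1 (hdisj i j h) hp.1)
      · exact absurd hp.1 (disjoint_left.1 (hdisj j i h) hp.2))
  refine ⟨Y, hY, fun ω s t hs hst => ?_⟩
  have hk : (0 : ℝ≥0) < (k : ℝ≥0) + 1 := by positivity
  set j := ⌊(s : ℝ≥0) * (k + 1)⌋₊ with hj
  have h1 : (j : ℝ≥0) / (k + 1) ≤ s := by
    rw [div_le_iff₀ hk]; exact Nat.floor_le (by positivity)
  have h2 : (s : ℝ≥0) < ((j + 1 : ℕ) : ℝ≥0) / (k + 1) := by
    rw [lt_div_iff₀ hk]; push_cast; exact Nat.lt_floor_add_one _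
  have h3 : ((j + 1 : ℕ) : ℝ≥0) / (k + 1) ≤ s + 1 / ((k : ℝ≥0) + 1) := by
    push_cast; rw [add_div]; gcongr
  have h4 : ((P (j + 1) : Time T) : ℝ≥0) = ((j + 1 : ℕ) : ℝ≥0) / (k + 1) :=
    min_eq_left (h3.trans (hst.le.trans t.2))
  have h5 : s < P (j + 1) := by rw [← Subtype.coe_lt_coe, h4]; exact h2
  have h6 : P (j + 1) < t := by rw [← Subtype.coe_lt_coe, h4]; exact h3.trans_lt hst
  have h7 : P j ≤ s := Subtype.coe_le_coe.1 ((min_le_left _ _).trans h1)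
  refine ⟨P (j + 1), h5, h4 ▸ h3, ?_⟩
  rw [hYE j (show (t, ω) ∈ E j from ⟨h6, by
    rw [mem_ofPred_eq, hs]; exact ⟨WithTop.coe_le_coe.2 h7, WithTop.coe_lt_coe.2 h5⟩⟩)]
  exact indicator_of_mem (show (t, ω) ∈ Ioi (P (j + 1)) ×ˢ (univ : Set Ω) from ⟨h6, mem_univ _⟩) _

/-- The right limit of an adapted process at a stopping time, as a predictable process after the
stopping time. -/
theorem exists_measurable_rightLim {φ : Time T → Ω → ℝ} (hφ : StronglyAdapted 𝓕 φ)
    {ρ : Ω → WithTop (Time T)} (hρ : IsStoppingTime 𝓕 ρ) :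
    ∃ U : Time T × Ω → ℝ, Measurable[𝓕.predictable] U ∧
      ∀ (ω : Ω) (s t : Time T) (l : ℝ), ρ ω = (s : WithTop (Time T)) → s < t →
        Tendsto (fun u => φ u ω) (𝓝[>] s) (𝓝 l) → U (t, ω) = l := by
  choose Y hY hYq using exists_measurable_delayed_value hφ hρ
  -- The limsup is measurable whether or not the right limit exists; nothing is claimed where it
  -- does not.
  refine ⟨fun p => limsup (fun k => Y k p) atTop, @Measurable.limsup _ _ _ _ _ 𝓕.predictable _ _ _ _
    hY, fun ω s t l hs hst hl => ?_⟩
  have hlim : Tendsto (fun k : ℕ => (s : ℝ≥0) + 1 / ((k : ℝ≥0) + 1)) atTop (𝓝 (s : ℝ≥0)) := by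
    have : Tendsto (fun k : ℕ => 1 / ((k : ℝ≥0) + 1)) atTop (𝓝 0) :=
      tendsto_one_div_add_atTop_nhds_zero_nat
    simpa using this.const_add (s : ℝ≥0)
  have hev : ∀ᶠ k : ℕ in atTop, (s : ℝ≥0) + 1 / ((k : ℝ≥0) + 1) < t :=
    hlim.eventually_lt_const (Subtype.coe_lt_coe.2 hst)
  have hq : ∀ k : ℕ, ∃ q : Time T, (s : ℝ≥0) + 1 / ((k : ℝ≥0) + 1) < t →
      s < q ∧ (q : ℝ≥0) ≤ s + 1 / ((k : ℝ≥0) + 1) ∧ Y k (t, ω) = φ q ω := by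
    intro k
    by_cases h : (s : ℝ≥0) + 1 / ((k : ℝ≥0) + 1) < t
    · obtain ⟨q, hq⟩ := hYq k ω s t hs h
      exact ⟨q, fun _ => hq⟩
    · exact ⟨s, fun h' => absurd h' h⟩
  choose q hq using hq
  have hqlim : Tendsto q atTop (𝓝[>] s) := by
    refine tendsto_nhdsWithin_iff.2 ⟨tendsto_subtype_rng.2 ?_, hev.mono fun k hk => (hq k hk).1⟩
    exact tendsto_of_tendsto_of_tendsto_of_le_of_le' tendsto_const_nhds hlim
      (hev.mono fun k hk => (Subtype.coe_lt_coe.2 (hq k hk).1).le)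
      (hev.mono fun k hk => (hq k hk).2.1)
  exact ((hl.comp hqlim).congr' (hev.mono fun k hk => ((hq k hk).2.2).symm)).limsup_eq

end Predictable

/-! ### First exit times -/

section NextTime

variable {T : ℝ≥0}

/-- `r'` is the first time after `r`, up to `τ`, at which the distance of `f` and `U` exceeds `ε`;
it is `τ` if there is none (unless `τ ≤ r`). If `G` fails, only `τ` is taken into account. -/
structure IsNextTime (G : Prop) (f U : Time T → ℝ) (ε : ℝ) (τ r r' : WithTop (Time T)) : Prop where
  le_of_exceeds : ∀ t : Time T, G → r < t → (t : WithTop (Time T)) ≤ τ → ε < |f t - U t| → r' ≤ t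
  le_end : r < τ → r' ≤ τ
  exists_of_lt : ∀ x, r' < x → (r < τ ∧ τ < x) ∨ ∃ t : Time T, G ∧ r < t ∧
    (t : WithTop (Time T)) ≤ τ ∧ ε < |f t - U t| ∧ (t : WithTop (Time T)) < x

end NextTime

section Step

variable {Ω : Type*} {m : MeasurableSpace Ω} {T : ℝ≥0} {𝓕 : Filtration (Time T) m}

theorem exists_nextTime [𝓕.IsRightContinuous] {P : Measure Ω} [IsFiniteMeasure P]
    (h𝓕 : IsCompleteFiltration 𝓕 P) {φ : Time T → Ω → ℝ} (hφ : IsStronglyPredictable 𝓕 φ)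
    {G : Set Ω} (hG : MeasurableSet[𝓕 ⊥] G) {τ ρ : Ω → WithTop (Time T)}
    (hτ : IsStoppingTime 𝓕 τ) (hρ : IsStoppingTime 𝓕 ρ) {U : Time T × Ω → ℝ}
    (hU : Measurable[𝓕.predictable] U) (ε : ℝ) :
    ∃ ρ' : Ω → WithTop (Time T), IsStoppingTime 𝓕 ρ' ∧
      ∀ ω, IsNextTime (ω ∈ G) (fun t => φ t ω) (fun t => U (t, ω)) ε (τ ω) (ρ ω) (ρ' ω) := by
  classical
  let A : Set (Time T × Ω) := {p | p.2 ∈ G} ∩ ({p | ρ p.2 < (p.1 : WithTop (Time T))} ∩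
    ({p | (p.1 : WithTop (Time T)) ≤ τ p.2} ∩ {p | ε < |φ p.1 p.2 - U p|}))
  have hA : MeasurableSet[𝓕.predictable] A := by
    refine MeasurableSet.inter (measurableSet_predictable_snd hG)
      ((measurableSet_predictable_lt hρ).inter ((measurableSet_predictable_le hτ).inter ?_))
    have h0 : Measurable[𝓕.predictable] (Function.uncurry φ) := StronglyMeasurable.measurable hφ
    have h1 : Measurable[𝓕.predictable] (Function.uncurry φ - U) := h0.sub hU
    have h2 : Measurable[𝓕.predictable] fun p => |(Function.uncurry φ - U) p| :=
      measurable_abs.comp h1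
    exact h2 measurableSet_Ioi
  obtain ⟨d, hd⟩ := exists_isDebut A
  have hdst : IsStoppingTime 𝓕 d := hd.isStoppingTime h𝓕 hA
  have hlt : ∀ ω, d ω ≠ ⊤ → ρ ω < τ ω := by
    intro ω hω
    obtain ⟨t, -, h1, h2, -⟩ := hd.2.2 ω hω
    exact h1.trans_le h2
  -- Once τ is reached the next time is ⊤, which ends the sequence. Restricting τ to {ρ < τ} keeps a
  -- stopping time because this event lies in the σ-algebra at τ.
  refine ⟨fun ω => min (d ω) (if ρ ω < τ ω then τ ω else ⊤), fun t => ?_, fun ω => ⟨?_, ?_, ?_⟩⟩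
  · have h1 : MeasurableSet[𝓕 t] ({ω | ρ ω < τ ω} ∩ {ω | τ ω ≤ (t : WithTop (Time T))}) := by
      have h2 := (hτ.measurableSet _).1 (hτ.measurableSet_le_stopping_time hρ).compl
      convert h2.2 t using 2
      ext ω
      simp
    convert (hdst t).union h1 using 1
    ext ω
    simp only [mem_ofPred_eq, mem_union, mem_inter_iff, min_le_iff]
    by_cases h : ρ ω < τ ω <;> simp [h]
  · intro t hG h1 h2 h3
    exact (min_le_left _ _).trans (hd.1 ω t ⟨hG, h1, h2, h3⟩)
  · intro h
    refine (min_le_right _ _).trans ?_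
    rw [if_pos h]
  · intro x hx
    rcases min_lt_iff.1 hx with h | h
    · obtain ⟨t, ⟨h1, h2, h3, h4⟩, h5⟩ := hd.2.1 ω x h
      exact Or.inr ⟨t, h1, h2, h3, h4, h5⟩
    · by_cases h' : ρ ω < τ ω
      · rw [if_pos h'] at h; exact Or.inl ⟨h', h⟩
      · rw [if_neg h'] at h; exact absurd h not_top_lt

end Step

/-! ### Pathwise analysis of the sampling times -/

section Sampling

variable {T : ℝ≥0} {G : Prop} {f : Time T → ℝ} {ε : ℝ} {τ : WithTop (Time T)}
  {r : ℕ → WithTop (Time T)} {U : ℕ → Time T → ℝ}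

theorem exists_rightLim_of_boundedVariationOn {a b s : Time T} (hf : BoundedVariationOn f (Icc a b))
    (ha : a ≤ s) (hb : s < b) : ∃ l, Tendsto f (𝓝[>] s) (𝓝 l) := by
  obtain ⟨l, hl⟩ := hf.exists_tendsto_right s
  refine ⟨l, hl.mono_left (nhdsWithin_le_iff.2 ?_)⟩
  filter_upwards [Ioo_mem_nhdsGT hb] with u hu
  exact ⟨⟨ha.trans hu.1.le, hu.2.le⟩, hu.1⟩

theorem exists_cell {k : ℕ} (hk : r k = ⊤) {t : Time T} (ht : r 0 < t) :
    ∃ k, r k < t ∧ (t : WithTop (Time T)) ≤ r (k + 1) := by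
  classical
  have hex : ∃ k, (t : WithTop (Time T)) ≤ r k := ⟨k, hk ▸ le_top⟩
  have h0 : Nat.find hex ≠ 0 := fun h0 => by
    have := Nat.find_spec hex
    rw [h0] at this
    exact absurd ht (not_lt.2 this)
  obtain ⟨j, hj⟩ := Nat.exists_eq_succ_of_ne_zero h0
  exact ⟨j, not_le.1 (Nat.find_min hex (by omega)), by
    have := Nat.find_spec hex
    rwa [hj] at this⟩

theorem IsNextTime.lt_end {V : Time T → ℝ} {s s' : WithTop (Time T)} (h : IsNextTime G f V ε τ s s')
    (hs : s' ≠ ⊤) : s < τ := by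
  rcases h.exists_of_lt ⊤ (lt_top_iff_ne_top.2 hs) with h1 | ⟨t, -, h1, h2, -⟩
  exacts [h1.1, h1.trans_le h2]

theorem IsNextTime.le {V : Time T → ℝ} {s s' : WithTop (Time T)} (h : IsNextTime G f V ε τ s s') :
    s ≤ s' := by
  by_contra hlt
  rcases h.exists_of_lt s (not_le.1 hlt) with h1 | ⟨t, -, h1, -, -, h2⟩
  · exact absurd (h1.1.trans h1.2) (lt_irrefl _)
  · exact absurd (h1.trans h2) (lt_irrefl _)

/-- Successive times `r k` at which `f` has moved by more than `ε` from its right limit at the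
previous one. -/
structure IsTimeSeq (G : Prop) (f : Time T → ℝ) (ε : ℝ) (τ : WithTop (Time T))
    (r : ℕ → WithTop (Time T)) (U : ℕ → Time T → ℝ) : Prop where
  next : ∀ k, IsNextTime G f (U k) ε τ (r k) (r (k + 1))
  rightLim : ∀ k (s t : Time T) (l : ℝ), r k = (s : WithTop (Time T)) → s < t →
    Tendsto f (𝓝[>] s) (𝓝 l) → U k t = l
  start : r 0 ≤ τ

namespace IsTimeSeq

theorem mono (h : IsTimeSeq G f ε τ r U) : Monotone r :=
  monotone_nat_of_le_succ fun k => (h.next k).le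

theorem le_end (h : IsTimeSeq G f ε τ r U) {k : ℕ} (hk : r k ≠ ⊤) : r k ≤ τ := by
  cases k with
  | zero => exact h.start
  | succ k => exact (h.next k).le_end ((h.next k).lt_end hk)

/-- Bounded variation gives a right limit at `r k`, and just after `r k` the path stays within ε of
it, so the threshold cannot be exceeded immediately. -/
theorem lt_succ_of_good (h : IsTimeSeq G f ε τ r U) (hε : 0 < ε) {a b : Time T}
    (ha : (a : WithTop (Time T)) ≤ r 0)
    (hb : ∀ t : Time T, (t : WithTop (Time T)) ≤ τ ↔ t ≤ b)
    (hf : BoundedVariationOn f (Icc a b)) {k : ℕ} (hk : r k ≠ ⊤) : r k < r (k + 1) := by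
  obtain ⟨s, hs⟩ := WithTop.ne_top_iff_exists.1 hk
  refine lt_of_le_of_ne (h.next k).le fun heq => ?_
  have hle : r (k + 1) ≤ s := by rw [← heq, hs]
  have hsτ : r k < τ := (h.next k).lt_end (heq ▸ hk)
  have has : a ≤ s := by
    rw [← WithTop.coe_le_coe, hs]; exact ha.trans (h.mono (Nat.zero_le k))
  by_cases hsb : s < b
  · obtain ⟨l, hl⟩ := exists_rightLim_of_boundedVariationOn hf has hsb
    have hev : ∀ᶠ u in 𝓝[>] s, |f u - l| < ε := by
      have := hl.eventually (Metric.ball_mem_nhds _ hε)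
      simpa only [Metric.mem_ball, Real.dist_eq] using this
    obtain ⟨y, hy, hyε⟩ := (mem_nhdsGT_iff_exists_mem_Ioc_Ioo_subset hsb).1 hev
    rcases (h.next k).exists_of_lt y (hle.trans_lt (WithTop.coe_lt_coe.2 hy.1)) with
      h1 | ⟨t, -, h1, -, h2, h3⟩
    · exact absurd ((hb y).2 hy.2) (not_le.2 h1.2)
    · rw [← hs] at h1
      have hst := WithTop.coe_lt_coe.1 h1
      rw [h.rightLim k s t l hs.symm hst hl] at h2
      exact absurd (hyε ⟨hst, WithTop.coe_lt_coe.1 h3⟩) (not_lt.2 h2.le)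
  · rcases (h.next k).exists_of_lt ⊤ (hle.trans_lt (WithTop.coe_lt_top s)) with
      h1 | ⟨t, -, h1, h2, -⟩
    · obtain ⟨t, ht⟩ := WithTop.ne_top_iff_exists.1 h1.2.ne
      rw [← ht, ← hs] at hsτ
      exact hsb ((WithTop.coe_lt_coe.1 hsτ).trans_le ((hb t).1 ht.le))
    · rw [← hs] at h1
      exact hsb ((WithTop.coe_lt_coe.1 h1).trans_le ((hb t).1 h2))

theorem end_le_succ_of_bad (h : IsTimeSeq G f ε τ r U) (hG : ¬ G) (k : ℕ) : τ ≤ r (k + 1) := by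
  by_contra hlt
  rcases (h.next k).exists_of_lt τ (not_le.1 hlt) with h1 | ⟨t, h1, -⟩
  · exact lt_irrefl _ h1.2
  · exact hG h1

theorem lt_succ_of_bad (h : IsTimeSeq G f ε τ r U) (hG : ¬ G) {k : ℕ} (hk : r k ≠ ⊤) :
    r k < r (k + 1) := by
  by_cases hk1 : r (k + 1) = ⊤
  · rw [hk1]; exact lt_top_iff_ne_top.2 hk
  · exact ((h.next k).lt_end hk1).trans_le (h.end_le_succ_of_bad hG k)

theorem ne_top_of_le (h : IsTimeSeq G f ε τ r U) {j k : ℕ} (hjk : j ≤ k) (hk : r k ≠ ⊤) : r j ≠ ⊤ :=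
  ne_top_of_le_ne_top hk (h.mono hjk)

theorem exists_eq_top_of_bad (h : IsTimeSeq G f ε τ r U) (hG : ¬ G) : r 2 = ⊤ := by
  by_contra hk
  exact absurd ((h.next 1).lt_end hk) (not_lt.2 (h.end_le_succ_of_bad hG 0))

/-- Infinitely many finite times would increase to some z. Near the left limit at z all values and
right limits are within ε/2 of each other, leaving no room for a move exceeding ε. -/
theorem exists_eq_top_of_good (h : IsTimeSeq G f ε τ r U) (hε : 0 < ε) {a b : Time T}
    (ha : (a : WithTop (Time T)) ≤ r 0)
    (hb : ∀ t : Time T, (t : WithTop (Time T)) ≤ τ ↔ t ≤ b)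
    (hf : BoundedVariationOn f (Icc a b)) : ∃ k, r k = ⊤ := by
  by_contra! hcon
  choose c hc using fun k => WithTop.ne_top_iff_exists.1 (hcon k)
  have hlt : ∀ k, c k < c (k + 1) := fun k => by
    have := h.lt_succ_of_good hε ha hb hf (hcon k)
    rw [← hc, ← hc] at this
    exact WithTop.coe_lt_coe.1 this
  have hcm : StrictMono c := strictMono_nat_of_lt_succ hlt
  have hcI : ∀ k, c k ∈ Icc a b := fun k => ⟨by
    rw [← WithTop.coe_le_coe, hc]; exact ha.trans (h.mono (Nat.zero_le k)),
    (hb _).1 (by rw [hc]; exact h.le_end (hcon k))⟩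
  have hbdd : BddAbove (range c) := ⟨b, by rintro _ ⟨k, rfl⟩; exact (hcI k).2⟩
  set z : Time T := ⨆ k, c k
  have hz : Tendsto c atTop (𝓝 z) := tendsto_atTop_ciSup hcm.monotone hbdd
  have hcz : ∀ k, c k < z := fun k => (hlt k).trans_le (le_ciSup hbdd (k + 1))
  obtain ⟨l, hl⟩ := hf.exists_tendsto_left z
  have hev : ∀ᶠ u in 𝓝[<] z, u ∈ Icc a b → |f u - l| < ε / 4 := by
    have h1 := hl.eventually (Metric.ball_mem_nhds l (show 0 < ε / 4 by positivity))
    rw [inter_comm, nhdsWithin_inter', eventually_inf_principal] at h1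
    simpa only [Metric.mem_ball, Real.dist_eq] using h1
  obtain ⟨y, hy, hyε⟩ := (mem_nhdsLT_iff_exists_mem_Ico_Ioo_subset (hcz 0)).1 hev
  obtain ⟨k, hk⟩ := (hz.eventually (lt_mem_nhds hy.2)).exists
  obtain ⟨l', hl'⟩ := exists_rightLim_of_boundedVariationOn hf (hcI k).1 ((hlt k).trans_le (hcI _).2)
  have hl'l : |l' - l| ≤ ε / 4 := by
    have : (𝓝[>] (c k)).NeBot := nhdsGT_neBot_of_exists_gt ⟨_, hlt k⟩
    refine le_of_tendsto ((hl'.sub_const l).abs) ?_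
    filter_upwards [Ioo_mem_nhdsGT (hlt k)] with u hu
    exact (hyε ⟨hk.trans hu.1, hu.2.trans (hcz _)⟩
      ⟨(hcI k).1.trans hu.1.le, hu.2.le.trans (hcI _).2⟩).le
  -- The threshold need not be exceeded at `c (k + 1)`, which is only an infimum; some exceedance
  -- does occur before `c (k + 2)`.
  rcases (h.next k).exists_of_lt (c (k + 2)) (by
    rw [← hc]; exact WithTop.coe_lt_coe.2 (hlt _)) with h1 | ⟨t, -, h1, h2, h3, h4⟩
  · exact absurd ((hb _).2 (hcI (k + 2)).2) (not_le.2 h1.2)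
  · rw [← hc] at h1
    have hct := WithTop.coe_lt_coe.1 h1
    have htc := WithTop.coe_lt_coe.1 h4
    rw [h.rightLim k (c k) t l' (hc k).symm hct hl'] at h3
    have h5 := hyε ⟨hk.trans hct, htc.trans (hcz _)⟩
      ⟨(hcI k).1.trans hct.le, htc.le.trans (hcI _).2⟩
    rw [abs_lt] at h5
    rw [abs_le] at hl'l
    rcases lt_abs.1 h3 with h6 | h6 <;> linarith

theorem finite (h : IsTimeSeq G f ε τ r U) {k : ℕ} (hk : r k = ⊤) : {n | r n ≠ ⊤}.Finite :=
  (finite_Iio k).subset fun n hn => by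
    by_contra hkn
    exact h.ne_top_of_le (not_lt.1 hkn) hn hk

/-- Replacing `f` by its value at the last `r k`, unless it differs by more than `ε`, does not
increase the variation. -/
theorem eVariationOn_le (h : IsTimeSeq G f ε τ r U) (hG : G) {a b : Time T}
    (ha : r 0 = (a : WithTop (Time T)))
    (hb : ∀ t : Time T, (t : WithTop (Time T)) ≤ τ ↔ t ≤ b)
    (hf : BoundedVariationOn f (Icc a b)) {N : ℕ} (hN : r N = ⊤) {ψ : Time T → ℝ} (hψa : ψ a = f a)
    (hψ : ∀ k (t : Time T), r k < t → (t : WithTop (Time T)) ≤ r (k + 1) → t ≤ b →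
      ψ t = if ε < |f t - U k t| then f t else U k t) :
    eVariationOn ψ (Icc a b) ≤ eVariationOn f (Icc a b) := by
  classical
  -- The time change `g` fixes the times of exceedance and sends the other points of cell k to one
  -- point `v k` just after `r k`, where f is within θ of its right limit.
  have hsel : ∀ θ > 0, ∃ g : Time T → Time T, MonotoneOn g (Icc a b) ∧
      MapsTo g (Icc a b) (Icc a b) ∧ ∀ t ∈ Icc a b, |f (g t) - ψ t| ≤ θ := by
    intro θ hθ
    have hv : ∀ k, ∃ v : Time T, ∀ u : Time T, r k < u → (u : WithTop (Time T)) ≤ r (k + 1) →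
        u ≤ b → r k < v ∧ v < r (k + 1) ∧ v ≤ b ∧ ∀ t : Time T, r k < t → |f v - U k t| ≤ θ := by
      intro k
      by_cases hex : ∃ u : Time T, r k < u ∧ (u : WithTop (Time T)) ≤ r (k + 1) ∧ u ≤ b
      · obtain ⟨u, hu1, hu2, hu3⟩ := hex
        obtain ⟨s, hs⟩ := WithTop.ne_top_iff_exists.1 hu1.ne_top
        rw [← hs] at hu1
        have hsu := WithTop.coe_lt_coe.1 hu1
        have has : a ≤ s := by
          rw [← WithTop.coe_le_coe, hs, ← ha]; exact h.mono (Nat.zero_le k)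
        obtain ⟨l, hl⟩ := exists_rightLim_of_boundedVariationOn hf has (hsu.trans_le hu3)
        have hev : ∀ᶠ u in 𝓝[>] s, |f u - l| < θ := by
          have := hl.eventually (Metric.ball_mem_nhds _ hθ)
          simpa only [Metric.mem_ball, Real.dist_eq] using this
        have : (𝓝[>] s).NeBot := nhdsGT_neBot_of_exists_gt ⟨u, hsu⟩
        obtain ⟨v, hv1, hv2⟩ := (hev.and (Ioo_mem_nhdsGT hsu)).exists
        refine ⟨v, fun _ _ _ _ => ⟨?_, (WithTop.coe_lt_coe.2 hv2.2).trans_le hu2,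
          hv2.2.le.trans hu3, fun t ht => ?_⟩⟩
        · rw [← hs]; exact WithTop.coe_lt_coe.2 hv2.1
        · rw [← hs] at ht
          rw [h.rightLim k s t l hs.symm (WithTop.coe_lt_coe.1 ht) hl]
          exact hv1.le
      · exact ⟨a, fun u h1 h2 h3 => absurd ⟨u, h1, h2, h3⟩ hex⟩
    choose v hv using hv
    have hκ : ∀ t : Time T, ∃ k, a < t → r k < t ∧ (t : WithTop (Time T)) ≤ r (k + 1) := by
      intro t
      by_cases hat : a < t
      · obtain ⟨k, hk⟩ := exists_cell hN (t := t) (by rw [ha]; exact WithTop.coe_lt_coe.2 hat)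
        exact ⟨k, fun _ => hk⟩
      · exact ⟨0, fun h' => absurd h' hat⟩
    choose κ hκ using hκ
    let g : Time T → Time T := fun t =>
      if a < t then (if ε < |f t - U (κ t) t| then t else v (κ t)) else a
    have hg : ∀ t, a < t → t ≤ b → r (κ t) < g t ∧ (g t : WithTop (Time T)) ≤ r (κ t + 1) ∧
        g t ≤ b ∧ |f (g t) - ψ t| ≤ θ ∧
        ((t : WithTop (Time T)) < r (κ t + 1) → g t = v (κ t)) ∧
        (g t = v (κ t) ∨ g t = t) ∧ v (κ t) < r (κ t + 1) := by
      intro t hat htb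
      obtain ⟨h1, h2⟩ := hκ t hat
      obtain ⟨h3, h4, h5, h6⟩ := hv _ t h1 h2 htb
      have h7 := hψ _ t h1 h2 htb
      by_cases hex : ε < |f t - U (κ t) t|
      · have hgt : g t = t := by simp only [g, if_pos hat, if_pos hex]
        rw [if_pos hex] at h7
        rw [hgt]
        refine ⟨h1, h2, htb, ?_, fun hlt => ?_, Or.inr rfl, h4⟩
        · rw [h7, sub_self, abs_zero]; exact hθ.le
        -- Exceedance inside a cell can happen only at its right end; this makes `g` monotone.
        · exact absurd ((h.next _).le_of_exceeds t hG h1 ((hb t).2 htb) hex) (not_le.2 hlt)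
      · have hgt : g t = v (κ t) := by simp only [g, if_pos hat, if_neg hex]
        rw [if_neg hex] at h7
        rw [hgt]
        exact ⟨h3, h4.le, h5, by rw [h7]; exact h6 t h1, fun _ => rfl, Or.inl rfl, h4⟩
    have hga : g a = a := by simp only [g, if_neg (lt_irrefl a)]
    have hag : ∀ t, a < t → t ≤ b → a < g t := fun t hat htb => by
      rw [← WithTop.coe_lt_coe, ← ha]
      exact (h.mono (Nat.zero_le _)).trans_lt (hg t hat htb).1
    refine ⟨g, fun t ht t' ht' htt' => ?_, fun t ht => ?_, fun t ht => ?_⟩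
    · rcases eq_or_lt_of_le ht.1 with rfl | hat
      · rw [hga]
        rcases eq_or_lt_of_le ht'.1 with rfl | hat'
        · rw [hga]
        · exact (hag t' hat' ht'.2).le
      rcases eq_or_lt_of_le htt' with rfl | hlt
      · exact le_rfl
      have hat' := hat.trans hlt
      obtain ⟨h1, h2, h3, -, h5, h6, h7⟩ := hg t hat ht.2
      obtain ⟨h1', h2', h3', -, h5', h6', h7'⟩ := hg t' hat' ht'.2
      rcases lt_trichotomy (κ t) (κ t') with hlt' | heq | hgt
      · exact WithTop.coe_le_coe.1 ((h2.trans (h.mono hlt')).trans h1'.le)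
      · have hin : (t : WithTop (Time T)) < r (κ t + 1) :=
          (WithTop.coe_lt_coe.2 hlt).trans_le (heq ▸ (hκ t' hat').2)
        rw [h5 hin]
        by_cases hin' : (t' : WithTop (Time T)) < r (κ t' + 1)
        · rw [h5' hin', heq]
        · rcases h6' with h6' | h6'
          · rw [h6', heq]
          · rw [h6']
            exact (WithTop.coe_lt_coe.1 (h7.trans_le (heq ▸ not_lt.1 hin'))).le
      · exact absurd (((hκ t' hat').2.trans (h.mono hgt)).trans_lt (hκ t hat).1)
          (not_lt.2 (WithTop.coe_le_coe.2 htt'))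
    · rcases eq_or_lt_of_le ht.1 with rfl | hat
      · rw [hga]; exact ht
      · exact ⟨(hag t hat ht.2).le, (hg t hat ht.2).2.2.1⟩
    · rcases eq_or_lt_of_le ht.1 with rfl | hat
      · rw [hga, hψa, sub_self, abs_zero]; exact hθ.le
      · exact (hg t hat ht.2).2.2.2.1
  choose g hg1 hg2 hg3 using fun k : ℕ => hsel (1 / ((k : ℝ) + 1)) Nat.one_div_pos_of_nat
  -- Each f ∘ `g k` has at most the variation of f, and variation is lower semicontinuous under
  -- pointwise limits.
  by_contra hlt
  have hlim : ∀ t ∈ Icc a b, Tendsto (fun k => (f ∘ g k) t) atTop (𝓝 (ψ t)) := by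
    intro t ht
    rw [tendsto_iff_dist_tendsto_zero]
    exact squeeze_zero (fun _ => dist_nonneg) (fun k => hg3 k t ht)
      tendsto_one_div_add_atTop_nhds_zero_nat
  obtain ⟨k, hk⟩ := (eVariationOn.lowerSemicontinuous_aux hlim (not_le.1 hlt)).exists
  exact absurd (eVariationOn.comp_le_of_monotoneOn f (g k) (hg1 k) (hg2 k)) (not_le.2 hk)

end IsTimeSeq

end Sampling

/-! ### Capped times, degenerate intervals and indicators -/

section CapAt

variable {ι : Type*} [LinearOrder ι]

@[simp]
theorem capAt_top (t : ι) : capAt ⊤ t = t := by simp [capAt]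

@[simp]
theorem capAt_coe (s t : ι) : capAt (s : WithTop ι) t = min s t := by
  rw [capAt, ← WithTop.coe_min, WithTop.untopD_coe]

variable [OrderTop ι]

theorem capAt_eq_min (s : WithTop ι) (t : ι) : capAt s t = min (capAt s ⊤) t := by
  induction s <;> simp

theorem coe_le_iff_le_capAt (s : WithTop ι) (t : ι) : (t : WithTop ι) ≤ s ↔ t ≤ capAt s ⊤ := by
  induction s <;> simp

theorem lt_coe_iff_capAt_lt (s : WithTop ι) (t : ι) : s < (t : WithTop ι) ↔ capAt s ⊤ < t := by
  induction s <;> simp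

theorem capAt_mono {s s' : WithTop ι} (h : s ≤ s') : capAt s ⊤ ≤ capAt s' ⊤ := by
  rw [← coe_le_iff_le_capAt]
  induction s with
  | top => rw [top_le_iff.1 h]; exact le_top
  | coe s => simpa using h

end CapAt

theorem costTerm_self {ι : Type*} [LinearOrder ι] (bid S ask φ : ι → ℝ) (a : ι) :
    costTerm bid S ask φ a a = 0 := by
  refine HasCostTerm.costTerm_eq fun ε hε => ⟨IntervalPartition.ofChain 0 (fun _ => a)
    monotone_const rfl rfl, fun P _ s hs => ⟨fun _ => ?_, fun h => absurd h.symm ENNReal.top_ne_zero⟩⟩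
  have hno : ∀ i : Fin P.n, False := fun i => by
    have h1 := hs.chain_lt i i.2
    have h2 := P.chain_mem i
    have h3 := P.chain_mem (i + 1)
    exact absurd h1 (not_lt.2 (h3.2.trans h2.1))
  rw [riemannSum, Finset.sum_eq_zero fun i _ => (hno i).elim,
    Finset.sum_eq_zero fun i _ => (hno i).elim]
  simpa using hε

/-- The function is the product of two step functions and of f composed with the clamping to [a, b],
each of bounded variation. -/
theorem boundedVariationOn_indicator_Ioc {ι : Type*} [LinearOrder ι] {a b : ι} (hab : a ≤ b)
    {f : ι → ℝ} (hf : BoundedVariationOn f (Icc a b)) :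
    BoundedVariationOn ((Ioc a b).indicator f) univ := by
  have hstep : ∀ c : ι, BoundedVariationOn ((Ioi c).indicator fun _ => (1 : ℝ)) univ := by
    intro c
    refine MonotoneOn.boundedVariationOn (C := 1) (fun x _ y _ hxy => ?_) fun x _ => ?_
    · by_cases hx : c < x
      · rw [indicator_of_mem (mem_Ioi.2 hx), indicator_of_mem (mem_Ioi.2 (hx.trans_le hxy))]
      · rw [indicator_of_notMem (by simpa using hx)]
        exact indicator_nonneg (fun _ _ => zero_le_one) y
    · by_cases hx : c < x
      · rw [indicator_of_mem (mem_Ioi.2 hx), abs_one]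
      · rw [indicator_of_notMem (by simpa using hx), abs_zero]; exact zero_le_one
  have h1 : BoundedVariationOn (fun x => 1 - (Ioi b).indicator (fun _ => (1 : ℝ)) x) univ :=
    (LipschitzWith.of_dist_le_mul (K := 1) fun x y => by
      rw [Real.dist_eq, Real.dist_eq, show (1 - x) - (1 - y) = -(x - y) by ring, abs_neg]
      simp : LipschitzWith 1 fun x : ℝ => 1 - x).comp_boundedVariationOn
      (hstep b)
  have h2 : BoundedVariationOn (f ∘ fun x => max a (min x b)) univ :=
    ne_top_of_le_ne_top hf (eVariationOn.comp_le_of_monotoneOn f _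
      (fun x _ y _ hxy => max_le_max le_rfl (min_le_min hxy le_rfl))
      fun x _ => ⟨le_max_left _ _, max_le hab (min_le_right _ _)⟩)
  convert ((hstep a).mul h2).mul h1 using 1
  ext x
  simp only [Pi.mul_apply, Function.comp_apply]
  by_cases hx : a < x
  · by_cases hx' : x ≤ b
    · rw [indicator_of_mem (show x ∈ Ioc a b from ⟨hx, hx'⟩), indicator_of_mem (mem_Ioi.2 hx),
        indicator_of_notMem (by simpa using hx'), min_eq_left hx', max_eq_right hx.le]
      ring
    · rw [indicator_of_notMem fun h => hx' h.2, indicator_of_mem (s := Ioi b) (by simpa using hx')]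
      ring
  · rw [indicator_of_notMem fun h => hx h.1, indicator_of_notMem (s := Ioi a) (by simpa using hx)]
    ring

/-! ### Construction of the almost simple approximation -/

section Approximation

variable {Ω : Type*} {m : MeasurableSpace Ω} {T : ℝ≥0} {𝓕 : Filtration (Time T) m}

/-- Approximation of a predictable process by an almost simple one with at most the same
variation. -/
theorem exists_almostSimple_approx [𝓕.IsRightContinuous] {P : Measure Ω} [IsFiniteMeasure P]
    (h𝓕 : IsCompleteFiltration 𝓕 P) {φ : Time T → Ω → ℝ} (hφ : IsStronglyPredictable 𝓕 φ)
    {K : ℝ} (hK : ∀ t ω, |φ t ω| ≤ K) {G : Set Ω} (hG : MeasurableSet[𝓕 ⊥] G)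
    {σ τ : Ω → WithTop (Time T)} (hσ : IsStoppingTime 𝓕 σ) (hτ : IsStoppingTime 𝓕 τ)
    (hστ : ∀ ω, σ ω ≤ τ ω)
    (hBV : ∀ ω ∈ G, BoundedVariationOn (φ · ω) (Icc (capAt (σ ω) ⊤) (capAt (τ ω) ⊤)))
    {ε : ℝ} (hε : 0 < ε) :
    ∃ ψ : Time T → Ω → ℝ, IsStronglyPredictable 𝓕 ψ ∧ (∀ t ω, |ψ t ω| ≤ K) ∧
      IsAlmostSimple 𝓕 (restrictIoc ψ σ τ) ∧
      (∀ ω (s : Time T), σ ω = (s : WithTop (Time T)) → ψ s ω = φ s ω) ∧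
      (∀ ω ∈ G, ∀ t, |φ t ω - ψ t ω| ≤ ε) ∧
      ∀ ω ∈ G, eVariationOn (ψ · ω) (Icc (capAt (σ ω) ⊤) (capAt (τ ω) ⊤)) ≤
        eVariationOn (φ · ω) (Icc (capAt (σ ω) ⊤) (capAt (τ ω) ⊤)) := by
  classical
  -- Right limit and next time are chosen for every stopping time simultaneously, so that the
  -- sequence can be defined by recursion.
  choose U hU hUr using fun ρ : {ρ : Ω → WithTop (Time T) // IsStoppingTime 𝓕 ρ} =>
    exists_measurable_rightLim hφ.stronglyAdapted ρ.2
  choose nx hnxst hnx using fun ρ : {ρ : Ω → WithTop (Time T) // IsStoppingTime 𝓕 ρ} =>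
    exists_nextTime h𝓕 hφ hG hτ ρ.2 (hU ρ) ε
  let R : ℕ → {ρ : Ω → WithTop (Time T) // IsStoppingTime 𝓕 ρ} := fun n =>
    Nat.rec ⟨σ, hσ⟩ (fun _ ρ => ⟨nx ρ, hnxst ρ⟩) n
  have hseq : ∀ ω, IsTimeSeq (ω ∈ G) (φ · ω) ε (τ ω) (fun k => (R k).1 ω)
      (fun k t => U (R k) (t, ω)) := fun ω =>
    ⟨fun k => hnx (R k) ω, fun k s t l hs hst hl => hUr (R k) ω s t l hs hst hl, hστ ω⟩
  have hφm : Measurable[𝓕.predictable] (Function.uncurry φ) := StronglyMeasurable.measurable hφ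
  let D : Set (Time T × Ω) := {p | σ p.2 < (p.1 : WithTop (Time T))} ∩
    {p | (p.1 : WithTop (Time T)) ≤ τ p.2}
  have hD : MeasurableSet[𝓕.predictable] D :=
    (measurableSet_predictable_lt hσ).inter (measurableSet_predictable_le hτ)
  let E : Option ℕ → Set (Time T × Ω) := fun o => o.elim ({p | p.2 ∈ G} ∩ D)ᶜ fun k =>
    {p | p.2 ∈ G} ∩ ({p | (R k).1 p.2 < (p.1 : WithTop (Time T))} ∩
      ({p | (p.1 : WithTop (Time T)) ≤ (R (k + 1)).1 p.2} ∩
        {p | (p.1 : WithTop (Time T)) ≤ τ p.2}))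
  have hE : ∀ o, MeasurableSet[𝓕.predictable] (E o) := by
    rintro (_ | k)
    · exact ((measurableSet_predictable_snd hG).inter hD).compl
    · exact (measurableSet_predictable_snd hG).inter ((measurableSet_predictable_lt (R k).2).inter
        ((measurableSet_predictable_le (R (k + 1)).2).inter (measurableSet_predictable_le hτ)))
  -- The `none` branch is φ outside ]σ, τ] and zero inside. The zero is used only for paths outside
  -- `G`, which makes the restricted process almost simple for every ω, not just almost surely.
  let F : Option ℕ → Time T × Ω → ℝ := fun o => o.elim (Dᶜ.indicator (Function.uncurry φ)) fun k p =>
    if ε < |(Function.uncurry φ - U (R k)) p| then Function.uncurry φ p else U (R k) p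
  have hF : ∀ o, Measurable[𝓕.predictable] (F o) := by
    rintro (_ | k)
    · exact hφm.indicator hD.compl
    · have h1 : Measurable[𝓕.predictable] (Function.uncurry φ - U (R k)) := hφm.sub (hU (R k))
      have h2 : Measurable[𝓕.predictable] fun p => |(Function.uncurry φ - U (R k)) p| :=
        measurable_abs.comp h1
      exact Measurable.ite (h2 measurableSet_Ioi) hφm (hU (R k))
  have hER : ∀ k p, p ∈ E (some k) → p ∈ {p : Time T × Ω | p.2 ∈ G} ∩ D := by
    rintro k p ⟨h1, h2, -, h4⟩
    exact ⟨h1, ((hseq p.2).mono (Nat.zero_le k)).trans_lt h2, h4⟩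
  have hEE : ∀ i j p, i < j → p ∈ E (some i) → p ∉ E (some j) := by
    rintro i j p hij ⟨-, -, h3, -⟩ ⟨-, h2, -⟩
    exact absurd (h3.trans ((hseq p.2).mono hij)) (not_le.2 h2)
  obtain ⟨Ψ, hΨm, hΨ⟩ := @exists_measurable_piecewise _ _ 𝓕.predictable _ (Option ℕ) _ _ E hE F hF
    (by
      rintro (_ | i) (_ | j) hij p ⟨hp1, hp2⟩
      · exact absurd rfl hij
      · exact absurd (hER j p hp2) hp1
      · exact absurd (hER i p hp1) hp2
      · rcases lt_or_gt_of_ne (fun h => hij (congrArg some h) : i ≠ j) with h | h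
        · exact absurd hp2 (hEE i j p h hp1)
        · exact absurd hp1 (hEE j i p h hp2))
  have hout : ∀ t ω, ¬ (ω ∈ G ∧ (t, ω) ∈ D) → Ψ (t, ω) = Dᶜ.indicator (Function.uncurry φ) (t, ω) :=
    fun t ω h => hΨ none h
  have hcell : ∀ ω ∈ G, ∀ k (t : Time T), (R k).1 ω < t → (t : WithTop (Time T)) ≤ (R (k + 1)).1 ω →
      (t : WithTop (Time T)) ≤ τ ω →
      Ψ (t, ω) = if ε < |φ t ω - U (R k) (t, ω)| then φ t ω else U (R k) (t, ω) :=
    fun ω hω k t h1 h2 h3 => hΨ (some k) ⟨hω, h1, h2, h3⟩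
  have htop : ∀ ω, ∃ k, (R k).1 ω = ⊤ := by
    intro ω
    by_cases hω : ω ∈ G
    · by_cases hs : σ ω = ⊤
      · exact ⟨0, hs⟩
      obtain ⟨s, hs⟩ := WithTop.ne_top_iff_exists.1 hs
      refine (hseq ω).exists_eq_top_of_good hε (a := capAt (σ ω) ⊤) ?_
        (coe_le_iff_le_capAt (τ ω)) (hBV ω hω)
      exact (coe_le_iff_le_capAt _ _).2 le_rfl
    · exact ⟨2, (hseq ω).exists_eq_top_of_bad hω⟩
  have hcover : ∀ ω (t : Time T), (t, ω) ∈ D → ∃ k, (R k).1 ω < t ∧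
      (t : WithTop (Time T)) ≤ (R (k + 1)).1 ω := by
    intro ω t ht
    obtain ⟨k, hk⟩ := htop ω
    exact exists_cell (r := fun k => (R k).1 ω) hk ht.1
  have hright : ∀ ω ∈ G, ∀ k (s t : Time T), (R k).1 ω = (s : WithTop (Time T)) → s < t →
      (t : WithTop (Time T)) ≤ τ ω → ∃ l, Tendsto (φ · ω) (𝓝[>] s) (𝓝 l) := by
    intro ω hω k s t hs hst ht
    refine exists_rightLim_of_boundedVariationOn (hBV ω hω) ?_
      (hst.trans_le ((coe_le_iff_le_capAt _ _).1 ht))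
    have h1 : ((capAt (σ ω) ⊤ : Time T) : WithTop (Time T)) ≤ (R k).1 ω :=
      ((coe_le_iff_le_capAt _ _).2 le_rfl).trans ((hseq ω).mono (Nat.zero_le k))
    rw [hs] at h1
    exact WithTop.coe_le_coe.1 h1
  have hΨgood : ∀ ω ∈ G, ∀ t, |φ t ω - Ψ (t, ω)| ≤ ε := by
    intro ω hω t
    by_cases ht : (t, ω) ∈ D
    · obtain ⟨k, h1, h2⟩ := hcover ω t ht
      rw [hcell ω hω k t h1 h2 ht.2]
      split_ifs with hex
      · rw [sub_self, abs_zero]; exact hε.le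
      · exact not_lt.1 hex
    · rw [hout t ω fun h => ht h.2, indicator_of_mem (show (t, ω) ∈ Dᶜ from ht)]
      simpa using hε.le
  have hvar : ∀ ω ∈ G, eVariationOn (fun t => Ψ (t, ω)) (Icc (capAt (σ ω) ⊤) (capAt (τ ω) ⊤)) ≤
      eVariationOn (φ · ω) (Icc (capAt (σ ω) ⊤) (capAt (τ ω) ⊤)) := by
    intro ω hω
    by_cases hs : σ ω = ⊤
    · rw [hs, capAt_top, eVariationOn.subsingleton]
      · exact zero_le
      · intro x hx y hy
        rw [top_le_iff.1 hx.1, top_le_iff.1 hy.1]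
    obtain ⟨s, hs⟩ := WithTop.ne_top_iff_exists.1 hs
    have hcap : capAt (σ ω) ⊤ = s := by rw [← hs]; simp
    obtain ⟨N, hN⟩ := htop ω
    refine (hseq ω).eVariationOn_le hω (a := capAt (σ ω) ⊤) ?_ (coe_le_iff_le_capAt (τ ω))
      (hBV ω hω) hN ?_ fun k t h1 h2 h3 =>
        hcell ω hω k t h1 h2 ((coe_le_iff_le_capAt _ _).2 h3)
    · rw [hcap]; exact hs.symm
    · have hnot : (capAt (σ ω) ⊤, ω) ∉ D := fun h => by
        have := h.1
        rw [mem_ofPred_eq, lt_coe_iff_capAt_lt] at this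
        exact lt_irrefl _ this
      change Ψ (capAt (σ ω) ⊤, ω) = φ (capAt (σ ω) ⊤) ω
      rw [hout _ ω fun h => hnot h.2, indicator_of_mem (show (_, ω) ∈ Dᶜ from hnot)]
      rfl
  have hrestr : ∀ ω t, restrictIoc (fun t ω => Ψ (t, ω)) σ τ t ω =
      D.indicator Ψ (t, ω) := fun ω t => rfl
  have hbad : ∀ ω, ω ∉ G → ∀ t, D.indicator Ψ (t, ω) = 0 := by
    intro ω hω t
    by_cases ht : (t, ω) ∈ D
    · rw [indicator_of_mem ht, hout t ω fun h => hω h.1]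
      exact indicator_of_notMem (show (t, ω) ∉ Dᶜ from fun h => h ht) _
    · exact indicator_of_notMem ht _
  refine ⟨fun t ω => Ψ (t, ω), ?_, fun t ω => ?_, ⟨?_, fun ω => ?_, fun n => (R n).1,
    fun n => (R n).2, fun n ω hn => ?_, fun ω => ?_, fun ω t ht => ?_, fun n ω s t hs hst ht => ?_⟩,
    fun ω s hs => ?_, hΨgood, hvar⟩
  · exact Measurable.stronglyMeasurable hΨm
  · change |Ψ (t, ω)| ≤ K
    have hK0 : 0 ≤ K := (abs_nonneg _).trans (hK t ω)
    by_cases hω : ω ∈ G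
    · by_cases ht : (t, ω) ∈ D
      · obtain ⟨k, h1, h2⟩ := hcover ω t ht
        rw [hcell ω hω k t h1 h2 ht.2]
        split_ifs with hex
        · exact hK t ω
        · obtain ⟨s, hs⟩ := WithTop.ne_top_iff_exists.1 h1.ne_top
          have hst : s < t := by rw [← hs] at h1; exact WithTop.coe_lt_coe.1 h1
          obtain ⟨l, hl⟩ := hright ω hω k s t hs.symm hst ht.2
          rw [hUr (R k) ω s t l hs.symm hst hl]
          have : (𝓝[>] s).NeBot := nhdsGT_neBot_of_exists_gt ⟨t, hst⟩
          exact le_of_tendsto' hl.abs fun u => hK u ω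
      · rw [hout t ω fun h => ht h.2, indicator_of_mem (show (t, ω) ∈ Dᶜ from ht)]
        exact hK t ω
    · rw [hout t ω fun h => hω h.1]
      by_cases ht : (t, ω) ∈ D
      · rw [indicator_of_notMem (show (t, ω) ∉ Dᶜ from fun h => h ht), abs_zero]; exact hK0
      · rw [indicator_of_mem (show (t, ω) ∈ Dᶜ from ht)]; exact hK t ω
  · have : Measurable[𝓕.predictable] (D.indicator Ψ) := hΨm.indicator hD
    exact Measurable.stronglyMeasurable this
  · simp only [hrestr]
    by_cases hω : ω ∈ G
    · have h1 : (fun t => D.indicator Ψ (t, ω)) =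
          (Ioc (capAt (σ ω) ⊤) (capAt (τ ω) ⊤)).indicator fun t => Ψ (t, ω) := by
        ext t
        have : (t, ω) ∈ D ↔ t ∈ Ioc (capAt (σ ω) ⊤) (capAt (τ ω) ⊤) :=
          and_congr (lt_coe_iff_capAt_lt _ _) (coe_le_iff_le_capAt _ _)
        simp only [indicator_apply, this]
      rw [h1]
      exact boundedVariationOn_indicator_Ioc (capAt_mono (hστ ω))
        (ne_top_of_le_ne_top (hBV ω hω) (hvar ω hω))
    · simp only [hbad ω hω]
      have : eVariationOn (fun _ : Time T => (0 : ℝ)) univ = 0 :=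
        eVariationOn.constant_on (by rintro _ ⟨x, -, rfl⟩ _ ⟨y, -, rfl⟩; rfl)
      rw [BoundedVariationOn, this]
      exact ENNReal.zero_ne_top
  · by_cases hω : ω ∈ G
    · exact (hseq ω).lt_succ_of_good hε (a := capAt (σ ω) ⊤)
        ((coe_le_iff_le_capAt _ _).2 le_rfl) (coe_le_iff_le_capAt (τ ω)) (hBV ω hω) hn
    · exact (hseq ω).lt_succ_of_bad hω hn
  · obtain ⟨k, hk⟩ := htop ω
    exact (hseq ω).finite hk
  · rw [hrestr]
    exact indicator_of_notMem (fun h => absurd h.1 (not_lt.2 (le_of_lt ht))) _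
  · change (R n).1 ω = _ at hs
    change _ < (R (n + 1)).1 ω at ht
    simp only [hrestr]
    -- Strictly before the next time no exceedance occurs, so the process is frozen at the right
    -- limit; past τ and on paths outside `G` it is zero.
    have hconst : ∀ u ∈ Ioc s t, D.indicator Ψ (u, ω) = D.indicator Ψ (t, ω) := by
      intro u hu
      by_cases hω : ω ∈ G
      · by_cases hsτ : (R n).1 ω < τ ω
        · have htτ : (t : WithTop (Time T)) ≤ τ ω := ht.le.trans (((hseq ω).next n).le_end hsτ)
          obtain ⟨l, hl⟩ := hright ω hω n s t hs hst htτ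
          have hval : ∀ v ∈ Ioc s t, D.indicator Ψ (v, ω) = l := by
            intro v hv
            have h1 : (R n).1 ω < v := by rw [hs]; exact WithTop.coe_lt_coe.2 hv.1
            have h2 : (v : WithTop (Time T)) ≤ t := WithTop.coe_le_coe.2 hv.2
            have h3 : (v, ω) ∈ D :=
              ⟨((hseq ω).mono (Nat.zero_le n)).trans_lt h1, h2.trans htτ⟩
            rw [indicator_of_mem h3, hcell ω hω n v h1 (h2.trans ht.le) h3.2, if_neg,
              hUr (R n) ω s v l hs hv.1 hl]
            intro hex
            exact absurd (((hseq ω).next n).le_of_exceeds v hω h1 h3.2 hex)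
              (not_le.2 (h2.trans_lt ht))
          rw [hval u hu, hval t ⟨hst, le_rfl⟩]
        · have hnot : ∀ v : Time T, s < v → (v, ω) ∉ D := fun v hv h => by
            have h1 := (not_lt.1 hsτ).trans_eq hs
            exact absurd (h.2.trans h1) (not_le.2 (WithTop.coe_lt_coe.2 hv))
          rw [indicator_of_notMem (hnot u hu.1), indicator_of_notMem (hnot t hst)]
      · rw [hbad ω hω, hbad ω hω]
    refine tendsto_const_nhds.congr' ?_
    filter_upwards [Ioc_mem_nhdsGT hst] with u hu
    exact (hconst u hu).symm
  · have hnot : (s, ω) ∉ D := fun h => by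
      have h1 : σ ω < (s : WithTop (Time T)) := h.1
      rw [hs] at h1
      exact lt_irrefl _ h1
    change Ψ (s, ω) = φ s ω
    rw [hout _ ω fun h => hnot h.2, indicator_of_mem (show (_, ω) ∈ Dᶜ from hnot)]
    rfl

end Approximation

end BidAsk

/-! ### The approximating sequence and its costs -/

theorem mainTheorem7 {Ω : Type*} {m : MeasurableSpace Ω} (P : Measure Ω) [IsProbabilityMeasure P]
    (T : ℝ≥0) (𝓕 : Filtration (Time T) m) [𝓕.IsRightContinuous]
    (h𝓕 : IsCompleteFiltration 𝓕 P)
    (bid S ask : Time T → Ω → ℝ)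
    (hbid : Adapted 𝓕 bid) (hS : Adapted 𝓕 S) (hask : Adapted 𝓕 ask)
    (hbid_cadlag : ∀ ω, IsCadlag fun t => bid t ω)
    (hS_cadlag : ∀ ω, IsCadlag fun t => S t ω)
    (hask_cadlag : ∀ ω, IsCadlag fun t => ask t ω)
    (hbidS : ∀ t ω, bid t ω ≤ S t ω) (hSask : ∀ t ω, S t ω ≤ ask t ω)
    (φ : Time T → Ω → ℝ) (hφ : IsStronglyPredictable 𝓕 φ)
    (hφ_bdd : ∃ K : ℝ, ∀ t ω, |φ t ω| ≤ K)
    (σ τ : Ω → WithTop (Time T)) (hσ : IsStoppingTime 𝓕 σ) (hτ : IsStoppingTime 𝓕 τ)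
    (hστ : ∀ ω, σ ω ≤ τ ω)
    (hspread : ∀ ω, ∃ δ : ℝ, 0 < δ ∧ ∀ t : Time T, σ ω ≤ (t : WithTop (Time T)) →
      (t : WithTop (Time T)) < τ ω → δ ≤ ask t ω - bid t ω)
    (hcost : ∀ᵐ ω ∂P, costTerm (bid · ω) (S · ω) (ask · ω) (φ · ω)
      (capAt (σ ω) ⊤) (capAt (τ ω) ⊤) < ∞) :
    ∃ φn : ℕ → Time T → Ω → ℝ,
      (∃ K : ℝ, ∀ n t ω, |φn n t ω| ≤ K) ∧
      (∀ n, IsStronglyPredictable 𝓕 (φn n)) ∧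
      (∀ n, IsAlmostSimple 𝓕 (restrictIoc (φn n) σ τ)) ∧
      (∀ n ω (s : Time T), σ ω = (s : WithTop (Time T)) → φn n s ω = φ s ω) ∧
      (∀ n : ℕ, 0 < n → ∀ᵐ ω ∂P, ∀ t : Time T, σ ω ≤ (t : WithTop (Time T)) →
        (t : WithTop (Time T)) ≤ τ ω → |φ t ω - φn n t ω| ≤ 1 / (n : ℝ)) ∧
      ∀ᵐ ω ∂P,
        (∀ t, costTerm (bid · ω) (S · ω) (ask · ω) (φ · ω)
          (capAt (σ ω) t) (capAt (τ ω) t) < ∞) ∧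
        (∀ n t, costTerm (bid · ω) (S · ω) (ask · ω) (φn n · ω)
          (capAt (σ ω) t) (capAt (τ ω) t) < ∞) ∧
        TendstoUniformly
          (fun n t => (costTerm (bid · ω) (S · ω) (ask · ω) (φn n · ω)
            (capAt (σ ω) t) (capAt (τ ω) t)).toReal)
          (fun t => (costTerm (bid · ω) (S · ω) (ask · ω) (φ · ω)
            (capAt (σ ω) t) (capAt (τ ω) t)).toReal)
          atTop := by
  obtain ⟨K, hK⟩ := hφ_bdd
  let G : Set Ω := {ω | costTerm (bid · ω) (S · ω) (ask · ω) (φ · ω)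
    (capAt (σ ω) ⊤) (capAt (τ ω) ⊤) < ∞}
  -- Completeness puts this almost sure event into the initial σ-algebra, so treating its complement
  -- separately preserves predictability.
  have hG : MeasurableSet[𝓕 ⊥] G := (h𝓕 Gᶜ (ae_iff.1 hcost)).of_compl
  have hab : ∀ ω, capAt (σ ω) ⊤ ≤ capAt (τ ω) ⊤ := fun ω => capAt_mono (hστ ω)
  have hX : ∀ ω, IsRegulated fun t => ask t ω - S t ω := fun ω =>
    (hask_cadlag ω).isRegulated.sub (hS_cadlag ω).isRegulated
  have hY : ∀ ω, IsRegulated fun t => S t ω - bid t ω := fun ω =>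
    (hS_cadlag ω).isRegulated.sub (hbid_cadlag ω).isRegulated
  have hBV : ∀ ω ∈ G, BoundedVariationOn (φ · ω) (Icc (capAt (σ ω) ⊤) (capAt (τ ω) ⊤)) := by
    intro ω hω
    have hω' : costTerm (bid · ω) (S · ω) (ask · ω) (φ · ω)
        (capAt (σ ω) ⊤) (capAt (τ ω) ⊤) < ∞ := hω
    obtain ⟨c, hc, hlt⟩ := sInf_lt_iff.1 hω'
    obtain ⟨δ, hδ, hδs⟩ := hspread ω
    refine HasCostTerm.boundedVariationOn (hab ω) (hX ω) (hY ω) (fun t => hSask t ω)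
      (fun t => hbidS t ω) hδ (fun t ht htb => hδs t ?_ ?_) hlt.ne hc
    · rw [← not_lt]
      intro h
      rcases eq_or_ne (σ ω) ⊤ with hs | hs
      · rw [hs, capAt_top] at ht
        exact absurd htb (not_lt.2 (le_top.trans ht))
      · obtain ⟨s, hs⟩ := WithTop.ne_top_iff_exists.1 hs
        rw [← hs, capAt_coe, min_eq_left le_top] at ht
        rw [← hs] at h
        exact absurd ht (not_le.2 (WithTop.coe_lt_coe.1 h))
    · rcases eq_or_ne (τ ω) ⊤ with hs | hs
      · rw [hs]; exact WithTop.coe_lt_top t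
      · obtain ⟨s, hs⟩ := WithTop.ne_top_iff_exists.1 hs
        rw [← hs, capAt_coe, min_eq_left le_top] at htb
        rw [← hs]
        exact WithTop.coe_lt_coe.2 htb
  choose ψ hψpred hψK hψsimple hψσ hψφ hψvar using fun n : ℕ =>
    exists_almostSimple_approx h𝓕 hφ hK hG hσ hτ hστ hBV (Nat.one_div_pos_of_nat (α := ℝ) (n := n))
  refine ⟨ψ, ⟨K, hψK⟩, hψpred, hψsimple, hψσ, fun n hn => ?_, ?_⟩
  · filter_upwards [hcost] with ω hω t _ _
    refine (hψφ n ω hω t).trans ?_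
    have : (0 : ℝ) < n := Nat.cast_pos.2 hn
    gcongr
    linarith
  · filter_upwards [hcost] with ω hω
    obtain ⟨h1, h2, h3⟩ := costTerm_tendsto_uniformly (hab ω) (hX ω) (hY ω) (fun t => hSask t ω)
      (fun t => hbidS t ω) (hBV ω hω) (fun n => hψvar n ω hω) tendsto_one_div_add_atTop_nhds_zero_nat
      fun n t _ => hψφ n ω hω t
    -- Either t is at or past σ and only the right endpoint is capped, or the interval degenerates
    -- to a point and both costs vanish.
    have hcap : ∀ t, (capAt (σ ω) t = capAt (σ ω) ⊤ ∧
        capAt (τ ω) t ∈ Icc (capAt (σ ω) ⊤) (capAt (τ ω) ⊤)) ∨ capAt (σ ω) t = capAt (τ ω) t := by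
      intro t
      rw [capAt_eq_min (σ ω) t, capAt_eq_min (τ ω) t]
      rcases le_total (capAt (σ ω) ⊤) t with h | h
      · exact Or.inl ⟨min_eq_left h, le_min (hab ω) h, min_le_left _ _⟩
      · exact Or.inr (by rw [min_eq_right h, min_eq_right (h.trans (hab ω))])
    refine ⟨fun t => ?_, fun n t => ?_, Metric.tendstoUniformly_iff.2 fun ε hε => ?_⟩
    · rcases hcap t with ⟨h, ht⟩ | h
      · rw [h]; exact h1 _ ht
      · rw [h, costTerm_self]; exact ENNReal.zero_lt_top
    · rcases hcap t with ⟨h, ht⟩ | h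
      · rw [h]; exact h2 n _ ht
      · rw [h, costTerm_self]; exact ENNReal.zero_lt_top
    · filter_upwards [h3 ε hε] with n hn t
      rcases hcap t with ⟨h, ht⟩ | h
      · rw [h]; exact hn _ ht
      · rw [h, costTerm_self, costTerm_self, dist_self]; exact hε
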